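/- Monadic formulas of order are built from the atomic formulas "$X$ is a singleton", "$X=\{x\}$, $Y=\{y\}$ and $x<y$", and "$X\subseteq Y$" by Boolean connectives and quantification over set variables; in a chain (linearly ordered set) $C$ the set variables range over all subsets of $C$. For a chain $C$ and a finite tuple $\bar A$ of subsets of $C$, let $\mathrm{Th}^0(C;\bar A)$ be the set of quantifier-free formulas satisfied by $\bar A$ in $C$, and let $\mathrm{Th}^{n+1}(C;\bar A)=\{\mathrm{Th}^n(C;\bar A^\frown B): B\subseteq C\}$. The depth $\mathrm{dp}(\psi)$ of a formula $\psi$ is the least $n$ such that, for all chains $C$ and tuples $\bar A$, $\mathrm{Th}^n(C;\bar A)$ determines whether $C\models\psi(\bar A)$; it is at most the syntactic quantifier depth of $\psi$. For a finite tuple $\bar P$ of subsets of $C$ (parameters), the formula $\psi(X,Y,\bar P)$ *uniformizes* $\varphi(X,Y)$ on $C$ if for every $Y\subseteq C$ such that $\varphi(X,Y)$ holds for some $X\subseteq C$ there is exactly one $X\subseteq C$ with $C\models\psi(X,Y,\bar P)$, and if $C\models\psi(X,Y,\bar P)$ implies $C\models\varphi(X,Y)$ for all $X,Y\subseteq C$.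 Proposition 5.2. Let $\varphi(X,Y)$ be the monadic formula saying: "if $Y$ is nonempty and has no last element, then $X\subseteq Y$ is an $\omega$-sequence (a set of order type $\omega$) unbounded in $Y$; and if not, then $X=\emptyset$". Then: 1. $\varphi$ cannot be uniformized in $(\omega^\omega,<)$: no formula $\psi(X,Y,\bar P)$ with any finite tuple $\bar P$ of subsets of $\omega^\omega$ uniformizes $\varphi$ on $\omega^\omega$. 2. Moreover, if for every $m<\omega$ the formula $\psi_m(X,Y,\bar P_m)$, with $\bar P_m$ a finite tuple of subsets of $\omega^m$, uniformizes $\varphi$ on $\omega^m$, then at least one of the sets $\{\mathrm{dp}(\psi_m):m<\omega\}$ and $\{\mathrm{lg}(\bar P_m):m<\omega\}$ is unbounded. -/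

import Mathlib

namespace MSO

/-- Formulas of the monadic second-order language of order, with free set variables
`X₀, …, X_{l-1}`. All variables are set variables; elements are treated as singletons.
A quantifier binds a new last variable. -/
inductive Formula : ℕ → Type
  /-- `X_i` is a singleton. -/
  | sing {l : ℕ} (i : Fin l) : Formula l
  /-- `X_i = {x}`, `X_j = {y}` and `x < y`. -/
  | lt {l : ℕ} (i j : Fin l) : Formula l
  /-- `X_i ⊆ X_j` (for a singleton `X_i = {x}` this is the membership `x ∈ X_j`). -/
  | sub {l : ℕ} (i j : Fin l) : Formula l
  | neg {l : ℕ} (φ : Formula l) : Formula l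
  | and {l : ℕ} (φ ψ : Formula l) : Formula l
  | ex {l : ℕ} (φ : Formula (l + 1)) : Formula l

/-- The tuple `A` followed by the set `B`. -/
def append {C : Type*} {l : ℕ} (A : Fin l → Set C) (B : Set C) : Fin (l + 1) → Set C :=
  Fin.snoc (α := fun _ => Set C) A B

@[simp] theorem append_castSucc {C : Type*} {l : ℕ} (A : Fin l → Set C) (B : Set C)
    (i : Fin l) : append A B i.castSucc = A i := by
  simp [append]

@[simp] theorem append_last {C : Type*} {l : ℕ} (A : Fin l → Set C) (B : Set C) :
    append A B (Fin.last l) = B := by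
  simp [append]

/-- Satisfaction `C ⊨ φ(A)` in a chain `C`; set variables range over all subsets of `C`. -/
def Sat (C : Type*) [LinearOrder C] : {l : ℕ} → Formula l → (Fin l → Set C) → Prop
  | _, .sing i, A => ∃ x, A i = {x}
  | _, .lt i j, A => ∃ x y, A i = {x} ∧ A j = {y} ∧ x < y
  | _, .sub i j, A => A i ⊆ A j
  | _, .neg φ, A => ¬ Sat C φ A
  | _, .and φ ψ, A => Sat C φ A ∧ Sat C ψ A
  | _, .ex φ, A => ∃ B : Set C, Sat C φ (append A B)

namespace Formula

/-- The (syntactic) quantifier depth. -/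
def qdepth : {l : ℕ} → Formula l → ℕ
  | _, .sing _ => 0
  | _, .lt _ _ => 0
  | _, .sub _ _ => 0
  | _, .neg φ => φ.qdepth
  | _, .and φ ψ => max φ.qdepth ψ.qdepth
  | _, .ex φ => φ.qdepth + 1

/-- `φ → ψ`. -/
def imp {l : ℕ} (φ ψ : Formula l) : Formula l := neg (and φ (neg ψ))

/-- `∀ X, φ`. -/
def all {l : ℕ} (φ : Formula (l + 1)) : Formula l := neg (ex (neg φ))

/-- `X_i` is an element of `X_j`, that is, `X_i = {x}` with `x ∈ X_j`. -/
def mem {l : ℕ} (i j : Fin l) : Formula l := and (sing i) (sub i j)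

/-- `X_i` is nonempty. -/
def nonempty {l : ℕ} (i : Fin l) : Formula l := ex (mem (Fin.last l) i.castSucc)

/-- `X_i` has a last element. -/
def hasLast {l : ℕ} (i : Fin l) : Formula l :=
  ex (and (mem (Fin.last l) i.castSucc)
    (all (imp (mem (Fin.last (l + 1)) i.castSucc.castSucc)
      (neg (lt (Fin.last l).castSucc (Fin.last (l + 1)))))))

/-- `X_i` has a first element. -/
def hasFirst {l : ℕ} (i : Fin l) : Formula l :=
  ex (and (mem (Fin.last l) i.castSucc)
    (all (imp (mem (Fin.last (l + 1)) i.castSucc.castSucc)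
      (neg (lt (Fin.last (l + 1)) (Fin.last l).castSucc)))))

/-- Every element of `X_j` is `≤` some element of `X_i`. -/
def cofinal {l : ℕ} (i j : Fin l) : Formula l :=
  all (imp (mem (Fin.last l) j.castSucc)
    (ex (and (mem (Fin.last (l + 1)) i.castSucc.castSucc)
      (neg (lt (Fin.last (l + 1)) (Fin.last l).castSucc)))))

/-- Some element of `X_j` is an upper bound of `X_i`. -/
def boundedBy {l : ℕ} (i j : Fin l) : Formula l :=
  ex (and (mem (Fin.last l) j.castSucc)
    (all (imp (mem (Fin.last (l + 1)) i.castSucc.castSucc)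
      (neg (lt (Fin.last l).castSucc (Fin.last (l + 1)))))))

/-- `X_i` is an `ω`-sequence: it is nonempty without last element, every nonempty subset of it
has a first element, and every nonempty subset of it bounded by one of its elements has a last
element. -/
def omegaSeq {l : ℕ} (i : Fin l) : Formula l :=
  and (and (nonempty i) (neg (hasLast i)))
    (all (imp (and (sub (Fin.last l) i.castSucc) (nonempty (Fin.last l)))
      (and (hasFirst (Fin.last l))
        (imp (boundedBy (Fin.last l) i.castSucc) (hasLast (Fin.last l))))))

/-- The formula `φ(X, Y)` (with `X` the variable `0` and `Y` the variable `1`): if `Y` is nonempty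
without a last element, then `X ⊆ Y` is an `ω`-sequence unbounded in `Y`, and if not,
then `X = ∅`. -/
def omegaCofinal : Formula 2 :=
  and
    (imp (and (nonempty 1) (neg (hasLast 1))) (and (sub 0 1) (and (omegaSeq 0) (cofinal 0 1))))
    (imp (neg (and (nonempty 1) (neg (hasLast 1)))) (neg (nonempty 0)))

end Formula

theorem nonempty_orderIso_nat_iff (T : Type*) [LinearOrder T] :
    Nonempty (T ≃o ℕ) ↔ (Nonempty T ∧ ¬ ∃ x : T, ∀ y, y ≤ x) ∧
      ∀ Z : Set T, Z.Nonempty → (∃ x, IsLeast Z x) ∧ (BddAbove Z → ∃ x, IsGreatest Z x) := by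
  constructor
  · rintro ⟨e⟩
    refine ⟨⟨⟨e.symm 0⟩, ?_⟩, ?_⟩
    · rintro ⟨x, hx⟩
      have h := e.monotone (hx (e.symm (e x + 1)))
      simp at h
    · rintro Z ⟨z, hz⟩
      constructor
      · have hne : (e '' Z).Nonempty := ⟨e z, z, hz, rfl⟩
        obtain ⟨x, hx, hxe⟩ := Nat.sInf_mem hne
        refine ⟨x, hx, fun y hy => ?_⟩
        rw [← e.le_iff_le, hxe]
        exact Nat.sInf_le ⟨y, hy, rfl⟩
      · rintro ⟨b, hb⟩
        have hne : (e '' Z).Nonempty := ⟨e z, z, hz, rfl⟩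
        have hbd : BddAbove (e '' Z) := ⟨e b, by rintro _ ⟨y, hy, rfl⟩; exact e.monotone (hb hy)⟩
        obtain ⟨x, hx, hxe⟩ := Nat.sSup_mem hne hbd
        refine ⟨x, hx, fun y hy => ?_⟩
        rw [← e.le_iff_le, hxe]
        exact le_csSup hbd ⟨y, hy, rfl⟩
  · rintro ⟨⟨hne, hmax⟩, hZ⟩
    have hfin : ∀ a b : T, (Set.Icc a b).Finite := by
      intro a b
      by_contra hinf
      have hinf : (Set.Icc a b).Infinite := hinf
      let f := hinf.natEmbedding
      have hfb : ∀ n, (f n : T) ≤ b := fun n => (f n).2.2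
      obtain ⟨g, hg⟩ := exists_increasing_or_nonincreasing_subseq (· < ·) (fun n => (f n : T))
      have hr : (Set.range fun n => (f (g n) : T)).Nonempty := ⟨_, 0, rfl⟩
      obtain ⟨⟨x, ⟨n, rfl⟩, hx⟩, hy⟩ := hZ _ hr
      obtain ⟨y, ⟨k, rfl⟩, hy⟩ := hy ⟨b, by rintro _ ⟨n, rfl⟩; exact hfb _⟩
      rcases hg with hg | hg
      · exact absurd (hy ⟨k + 1, rfl⟩) (not_le.2 (hg k (k + 1) k.lt_succ_self))
      · have h1 : (f (g n) : T) ≤ f (g (n + 1)) := hx ⟨n + 1, rfl⟩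
        have h2 : (f (g (n + 1)) : T) ≤ f (g n) := not_lt.1 (hg n (n + 1) n.lt_succ_self)
        have h3 := g.injective (f.injective (Subtype.ext (le_antisymm h1 h2)))
        omega
    let _ : LocallyFiniteOrder T := LocallyFiniteOrder.ofFiniteIcc hfin
    let _ : SuccOrder T := LinearLocallyFiniteOrder.succOrder T
    let _ : PredOrder T := LinearLocallyFiniteOrder.predOrder T
    have _ : NoMaxOrder T := ⟨fun a => by
      by_contra h
      exact hmax ⟨a, fun y => not_lt.1 fun hy => h ⟨y, hy⟩⟩⟩
    obtain ⟨⟨x, -, hx⟩, -⟩ := hZ Set.univ Set.univ_nonempty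
    let _ : OrderBot T := { bot := x, bot_le := fun y => hx trivial }
    exact ⟨orderIsoNatOfLinearSuccPredArch⟩

section Semantics

variable {C : Type*} [LinearOrder C] {l : ℕ} (A : Fin l → Set C)

theorem sat_imp (φ ψ : Formula l) : Sat C (φ.imp ψ) A ↔ (Sat C φ A → Sat C ψ A) := by
  simp [Formula.imp, Sat]

theorem sat_all (φ : Formula (l + 1)) :
    Sat C φ.all A ↔ ∀ B : Set C, Sat C φ (append A B) := by
  simp [Formula.all, Sat]

theorem sat_mem (i j : Fin l) : Sat C (.mem i j) A ↔ ∃ x ∈ A j, A i = {x} := by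
  simp only [Formula.mem, Sat]
  constructor
  · rintro ⟨⟨x, hx⟩, h⟩
    exact ⟨x, by rw [hx] at h; exact Set.singleton_subset_iff.1 h, hx⟩
  · rintro ⟨x, hx, h⟩
    exact ⟨⟨x, h⟩, by rw [h]; exact Set.singleton_subset_iff.2 hx⟩

theorem sat_nonempty (i : Fin l) : Sat C (.nonempty i) A ↔ (A i).Nonempty := by
  simp only [Formula.nonempty, Sat, sat_mem, append_castSucc, append_last]
  exact ⟨fun ⟨_, x, hx, _⟩ => ⟨x, hx⟩, fun ⟨x, hx⟩ => ⟨{x}, x, hx, rfl⟩⟩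

theorem sat_hasLast (i : Fin l) : Sat C (.hasLast i) A ↔ ∃ x, IsGreatest (A i) x := by
  simp only [Formula.hasLast, Sat, sat_mem, sat_all, sat_imp, append_castSucc, append_last]
  constructor
  · rintro ⟨_, ⟨x, hx, rfl⟩, h⟩
    refine ⟨x, hx, fun y hy => ?_⟩
    by_contra hlt
    exact h {y} ⟨y, hy, rfl⟩ ⟨x, y, rfl, rfl, not_le.1 hlt⟩
  · rintro ⟨x, hx, h⟩
    refine ⟨{x}, ⟨x, hx, rfl⟩, ?_⟩
    rintro _ ⟨y, hy, rfl⟩ ⟨a, b, ha, hb, hab⟩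
    rw [← Set.singleton_injective ha, ← Set.singleton_injective hb] at hab
    exact absurd (h hy) (not_le.2 hab)

theorem sat_hasFirst (i : Fin l) : Sat C (.hasFirst i) A ↔ ∃ x, IsLeast (A i) x := by
  simp only [Formula.hasFirst, Sat, sat_mem, sat_all, sat_imp, append_castSucc, append_last]
  constructor
  · rintro ⟨_, ⟨x, hx, rfl⟩, h⟩
    refine ⟨x, hx, fun y hy => ?_⟩
    by_contra hlt
    exact h {y} ⟨y, hy, rfl⟩ ⟨y, x, rfl, rfl, not_le.1 hlt⟩
  · rintro ⟨x, hx, h⟩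
    refine ⟨{x}, ⟨x, hx, rfl⟩, ?_⟩
    rintro _ ⟨y, hy, rfl⟩ ⟨a, b, ha, hb, hab⟩
    rw [← Set.singleton_injective ha, ← Set.singleton_injective hb] at hab
    exact absurd (h hy) (not_le.2 hab)

theorem sat_boundedBy (i j : Fin l) :
    Sat C (.boundedBy i j) A ↔ ∃ x ∈ A j, x ∈ upperBounds (A i) := by
  simp only [Formula.boundedBy, Sat, sat_mem, sat_all, sat_imp, append_castSucc, append_last]
  constructor
  · rintro ⟨_, ⟨x, hx, rfl⟩, h⟩
    refine ⟨x, hx, fun y hy => ?_⟩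
    by_contra hlt
    exact h {y} ⟨y, hy, rfl⟩ ⟨x, y, rfl, rfl, not_le.1 hlt⟩
  · rintro ⟨x, hx, h⟩
    refine ⟨{x}, ⟨x, hx, rfl⟩, ?_⟩
    rintro _ ⟨y, hy, rfl⟩ ⟨a, b, ha, hb, hab⟩
    rw [← Set.singleton_injective ha, ← Set.singleton_injective hb] at hab
    exact absurd (h hy) (not_le.2 hab)

theorem sat_cofinal (i j : Fin l) :
    Sat C (.cofinal i j) A ↔ ∀ y ∈ A j, ∃ x ∈ A i, y ≤ x := by
  simp only [Formula.cofinal, Sat, sat_mem, sat_all, sat_imp, append_castSucc, append_last]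
  constructor
  · intro h y hy
    obtain ⟨_, ⟨x, hx, rfl⟩, hn⟩ := h {y} ⟨y, hy, rfl⟩
    refine ⟨x, hx, ?_⟩
    by_contra hlt
    exact hn ⟨x, y, rfl, rfl, not_le.1 hlt⟩
  · rintro h _ ⟨y, hy, rfl⟩
    obtain ⟨x, hx, hyx⟩ := h y hy
    refine ⟨{x}, ⟨x, hx, rfl⟩, ?_⟩
    rintro ⟨a, b, ha, hb, hab⟩
    rw [← Set.singleton_injective ha, ← Set.singleton_injective hb] at hab
    exact absurd hyx (not_le.2 hab)

/-- The formula `omegaSeq` says, in every chain, that the set has order type `ω`. -/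
theorem sat_omegaSeq (i : Fin l) : Sat C (.omegaSeq i) A ↔ Nonempty (A i ≃o ℕ) := by
  simp only [Formula.omegaSeq, Sat, sat_all, sat_imp, sat_nonempty, sat_hasLast, sat_hasFirst,
    sat_boundedBy, append_castSucc, append_last]
  rw [nonempty_orderIso_nat_iff]
  generalize A i = S
  refine and_congr (and_congr Set.nonempty_coe_sort.symm (not_congr ?_)) ?_
  · exact ⟨fun ⟨x, hx, h⟩ => ⟨⟨x, hx⟩, fun y => h y.2⟩,
      fun ⟨x, h⟩ => ⟨x, x.2, fun y hy => h ⟨y, hy⟩⟩⟩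
  constructor
  · intro h Z hZ
    obtain ⟨h1, h2⟩ := h (Subtype.val '' Z) ⟨by rintro _ ⟨y, -, rfl⟩; exact y.2, hZ.image _⟩
    constructor
    · obtain ⟨_, ⟨x, hx, rfl⟩, hm⟩ := h1
      exact ⟨x, hx, fun y hy => hm ⟨y, hy, rfl⟩⟩
    · rintro ⟨b, hb⟩
      obtain ⟨_, ⟨x, hx, rfl⟩, hm⟩ := h2 ⟨b, b.2, by rintro _ ⟨y, hy, rfl⟩; exact hb hy⟩
      exact ⟨x, hx, fun y hy => hm ⟨y, hy, rfl⟩⟩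
  · rintro h B ⟨hB, z, hz⟩
    obtain ⟨h1, h2⟩ := h (Subtype.val ⁻¹' B) ⟨⟨z, hB hz⟩, hz⟩
    constructor
    · obtain ⟨x, hx, hm⟩ := h1
      exact ⟨x, hx, fun y hy => hm (a := ⟨y, hB hy⟩) hy⟩
    · rintro ⟨b, hbS, hb⟩
      obtain ⟨x, hx, hm⟩ := h2 ⟨⟨b, hbS⟩, fun y hy => hb hy⟩
      exact ⟨x, hx, fun y hy => hm (a := ⟨y, hB hy⟩) hy⟩

/-- The meaning of the formula `omegaCofinal`. -/
theorem sat_omegaCofinal (A : Fin 2 → Set C) :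
    Sat C .omegaCofinal A ↔
      (((A 1).Nonempty ∧ ¬ ∃ y, IsGreatest (A 1) y) →
        A 0 ⊆ A 1 ∧ Nonempty (A 0 ≃o ℕ) ∧ ∀ y ∈ A 1, ∃ x ∈ A 0, y ≤ x) ∧
      (¬ ((A 1).Nonempty ∧ ¬ ∃ y, IsGreatest (A 1) y) → A 0 = ∅) := by
  simp only [Formula.omegaCofinal, sat_imp, Sat, sat_nonempty, sat_hasLast, sat_omegaSeq,
    sat_cofinal, Set.not_nonempty_iff_eq_empty]

end Semantics

/-- `ψ(X, Y, P)` uniformizes `φ(X, Y)` in the chain `C`, where `P` is a tuple of `l` subsets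
of `C`: whenever some `X` satisfies `φ(X, Y)`, exactly one `X` satisfies `ψ(X, Y, P)`,
and `ψ(X, Y, P)` implies `φ(X, Y)`. The variables of `ψ` are `X, Y, P₀, …, P_{l-1}`. -/
def Uniformizes (C : Type*) [LinearOrder C] {l : ℕ} (ψ : Formula (l + 2)) (P : Fin l → Set C)
    (φ : Formula 2) : Prop :=
  (∀ Y : Set C, (∃ X : Set C, Sat C φ ![X, Y]) →
    ∃! X : Set C, Sat C ψ (Matrix.vecCons X (Matrix.vecCons Y P))) ∧
  ∀ X Y : Set C, Sat C ψ (Matrix.vecCons X (Matrix.vecCons Y P)) → Sat C φ ![X, Y]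

/-- The values of the `n`-theory of an `l`-tuple. -/
def TheoryType : ℕ → ℕ → Type
  | 0, l => Set (Formula l)
  | n + 1, l => Set (TheoryType n (l + 1))

/-- The `n`-theory `Th^n(C; A)`: for `n = 0` the set of quantifier-free formulas true of `A` in
`C`, and `Th^{n+1}(C; A) = {Th^n(C; A⌢B) : B ⊆ C}`. -/
def Th (C : Type*) [LinearOrder C] : (n : ℕ) → {l : ℕ} → (Fin l → Set C) → TheoryType n l
  | 0, l, A => ({φ | φ.qdepth = 0 ∧ Sat C φ A} : Set (Formula l))
  | n + 1, l, A => ({t | ∃ B : Set C, t = Th C n (append A B)} : Set (TheoryType n (l + 1)))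

/-- Whether `C ⊨ ψ(A)` is determined by `Th^n(C; A)`, for all chains `C`. -/
def DecidedBy {l : ℕ} (ψ : Formula l) (n : ℕ) : Prop :=
  ∀ (C C' : Type) [LinearOrder C] [LinearOrder C'] (A : Fin l → Set C) (A' : Fin l → Set C'),
    Th C n A = Th C' n A' → (Sat C ψ A ↔ Sat C' ψ A')

/-- The depth `dp(ψ)`: the least `n` such that `Th^n(C; A)` decides whether `C ⊨ ψ(A)`. -/
noncomputable def dp {l : ℕ} (ψ : Formula l) : ℕ := sInf {n | DecidedBy ψ n}

section Depth

variable {C C' : Type*} [LinearOrder C] [LinearOrder C']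

theorem exists_of_Th_succ_eq {n l : ℕ} {A : Fin l → Set C} {A' : Fin l → Set C'}
    (h : Th C (n + 1) A = Th C' (n + 1) A') (B : Set C) :
    ∃ B' : Set C', Th C n (append A B) = Th C' n (append A' B') := by
  have hB : Th C n (append A B) ∈
      ({t | ∃ B : Set C, t = Th C n (append A B)} : Set (TheoryType n (l + 1))) := ⟨B, rfl⟩
  have h' : ({t | ∃ B : Set C, t = Th C n (append A B)} : Set (TheoryType n (l + 1))) =
    {t | ∃ B : Set C', t = Th C' n (append A' B)} := h
  rw [h'] at hB
  exact hB

theorem sat_iff_of_Th_zero_eq {l : ℕ} {A : Fin l → Set C} {A' : Fin l → Set C'}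
    (h : Th C 0 A = Th C' 0 A') (φ : Formula l) (hφ : φ.qdepth = 0) :
    Sat C φ A ↔ Sat C' φ A' := by
  have h' : ({φ | φ.qdepth = 0 ∧ Sat C φ A} : Set (Formula l)) =
    {φ | φ.qdepth = 0 ∧ Sat C' φ A'} := h
  have h2 := Set.ext_iff.1 h' φ
  simpa [hφ] using h2

theorem sat_atom_of_Th_eq (n : ℕ) : ∀ {l : ℕ} {A : Fin l → Set C} {A' : Fin l → Set C'},
    Th C n A = Th C' n A' → ∀ i j : Fin l,
      (Sat C (.sing i) A ↔ Sat C' (.sing i) A') ∧ (Sat C (.lt i j) A ↔ Sat C' (.lt i j) A') ∧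
      (Sat C (.sub i j) A ↔ Sat C' (.sub i j) A') := by
  induction n with
  | zero =>
    intro l A A' h i j
    exact ⟨sat_iff_of_Th_zero_eq h _ rfl, sat_iff_of_Th_zero_eq h _ rfl,
      sat_iff_of_Th_zero_eq h _ rfl⟩
  | succ n ih =>
    intro l A A' h i j
    obtain ⟨B', hB'⟩ := exists_of_Th_succ_eq h ∅
    simpa [Sat] using ih hB' i.castSucc j.castSucc

theorem sat_iff_of_Th_eq {l : ℕ} (ψ : Formula l) : ∀ {n : ℕ}, ψ.qdepth ≤ n →
    ∀ {A : Fin l → Set C} {A' : Fin l → Set C'}, Th C n A = Th C' n A' →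
      (Sat C ψ A ↔ Sat C' ψ A') := by
  induction ψ with
  | sing i => exact fun _ _ _ h => (sat_atom_of_Th_eq _ h i i).1
  | lt i j => exact fun _ _ _ h => (sat_atom_of_Th_eq _ h i j).2.1
  | sub i j => exact fun _ _ _ h => (sat_atom_of_Th_eq _ h i j).2.2
  | neg φ ih => exact fun hn _ _ h => not_congr (ih hn h)
  | and φ ψ ih₁ ih₂ =>
    exact fun hn _ _ h => and_congr (ih₁ ((le_max_left _ _).trans hn) h)
      (ih₂ ((le_max_right _ _).trans hn) h)
  | ex φ ih =>
    intro n hn A A' h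
    obtain ⟨k, rfl⟩ : ∃ k, n = k + 1 := by
      cases n with
      | zero => simp [Formula.qdepth] at hn
      | succ k => exact ⟨k, rfl⟩
    have hk : φ.qdepth ≤ k := by simpa [Formula.qdepth] using hn
    constructor
    · rintro ⟨B, hB⟩
      obtain ⟨B', hB'⟩ := exists_of_Th_succ_eq h B
      exact ⟨B', (ih hk hB').1 hB⟩
    · rintro ⟨B', hB⟩
      obtain ⟨B, hB'⟩ := exists_of_Th_succ_eq h.symm B'
      exact ⟨B, (ih hk hB'.symm).2 hB⟩

end Depth

/-- Every formula is decided by the theory of its quantifier depth, so `dp` is well defined. -/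
theorem decidedBy_qdepth {l : ℕ} (ψ : Formula l) : DecidedBy ψ ψ.qdepth :=
  fun _ _ _ _ _ _ h => sat_iff_of_Th_eq ψ le_rfl h

theorem dp_le_qdepth {l : ℕ} (ψ : Formula l) : dp ψ ≤ ψ.qdepth :=
  Nat.sInf_le (decidedBy_qdepth ψ)

end MSO

/-! The argument is a pigeonhole on types with a composition theorem. Replacing the quantifier-free
part of `Th` by finitely many atomic facts gives types `ty` with finite range, which determine `Th`
(`Th_eq_of_ty_eq`) and such that the type of an ordered sum depends only on the types of the
summands (`ty_iUnion`).

In a chain containing a copy of `ω ^ m`, Ramsey's theorem yields a set `Y` arranged as nested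
`ω`-sums of blocks and gaps whose types depend only on their rank (`Rich.exists_good`). If `m`
exceeds the number of possible pairs of types, two ranks `r < s` have the same block type and the
same gap type.

Now let `X` be a cofinal `ω`-sequence in a block of rank `s + 1`. It meets some rank `s` component
`E (i + 1)`, hence meets the preceding component `E i` in a finite set. Past the last such point, `E
i` still contains a block `F` of rank `r` (`Good.exists_cut`), disjoint from `X` but of the same
type as `E (i + 1)`. The chain splits around `E (i + 1)` and around `F` into summands of pairwise
equal types: below, an extra copy is hidden because a whole block of rank `s` has the type of one of
rank `r`; above, because an `ω`-sum absorbs an extra initial summand. Carrying `X` across this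
correspondence costs one quantifier and produces `X' ≠ X` of the same type, so a formula of the
given depth cannot single out `X`. The bound on `m` depends only on depth and number of parameters,
which gives both statements. -/

namespace MSO

/-! ### Types with finite range and the composition theorem. -/

/-- Every element of `S` lies below every element of `T`. -/
def Prec {C : Type*} [LinearOrder C] (S T : Set C) : Prop := ∀ x ∈ S, ∀ y ∈ T, x < y

/-- The range of the `n`-types of `l`-tuples. An atomic type records which sets are empty, which
are singletons, which pairs are increasing pairs of singletons, and the inclusions. -/
def TypeVal : ℕ → ℕ → Type
  | 0, l => (Fin l → Prop) × (Fin l → Prop) × (Fin l → Fin l → Prop) × (Fin l → Fin l → Prop)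
  | n + 1, l => Set (TypeVal n (l + 1))

instance finite_typeVal : (n l : ℕ) → Finite (TypeVal n l)
  | 0, l => by unfold TypeVal; infer_instance
  | n + 1, l => by
    have := finite_typeVal n (l + 1)
    unfold TypeVal
    infer_instance

/-- The `n`-type of the traces of the sets `A` on the subchain `S`. -/
def ty {C : Type*} [LinearOrder C] (S : Set C) : (n : ℕ) → {l : ℕ} → (Fin l → Set C) → TypeVal n l
  | 0, l, A => ((fun i => A i ∩ S = ∅, fun i => ∃ x, A i ∩ S = {x},
      fun i j => ∃ x y, A i ∩ S = {x} ∧ A j ∩ S = {y} ∧ x < y, fun i j => A i ∩ S ⊆ A j) :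
      (Fin l → Prop) × (Fin l → Prop) × (Fin l → Fin l → Prop) × (Fin l → Fin l → Prop))
  | n + 1, l, A => ({t | ∃ B : Set C, t = ty S n (append A B)} : Set (TypeVal n (l + 1)))

/-- The type of an ordered sum, computed from the types of the summands. -/
def sumType {I : Type*} [LinearOrder I] : (n : ℕ) → {l : ℕ} → (I → TypeVal n l) → TypeVal n l
  | 0, l, f =>
    let f' : I → (Fin l → Prop) × (Fin l → Prop) × (Fin l → Fin l → Prop) ×
      (Fin l → Fin l → Prop) := f
    ((fun i => ∀ a, (f' a).1 i, fun i => ∃ a, (f' a).2.1 i ∧ ∀ c ≠ a, (f' c).1 i,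
      fun i j => ∃ a b, ((f' a).2.1 i ∧ ∀ c ≠ a, (f' c).1 i) ∧
        ((f' b).2.1 j ∧ ∀ c ≠ b, (f' c).1 j) ∧ (a < b ∨ (a = b ∧ (f' a).2.2.1 i j)),
      fun i j => ∀ a, (f' a).2.2.2 i j) :
      (Fin l → Prop) × (Fin l → Prop) × (Fin l → Fin l → Prop) × (Fin l → Fin l → Prop))
  | n + 1, l, f =>
    let f' : I → Set (TypeVal n (l + 1)) := f
    ({t | ∃ g : I → TypeVal n (l + 1), (∀ a, g a ∈ f' a) ∧ t = sumType n g} :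
      Set (TypeVal n (l + 1)))

section Types

variable {C : Type*} [LinearOrder C]

theorem ty_zero_eq_iff {S S' : Set C} {l : ℕ} {A A' : Fin l → Set C} :
    ty S 0 A = ty S' 0 A' ↔ (∀ i, A i ∩ S = ∅ ↔ A' i ∩ S' = ∅) ∧
      (∀ i, (∃ x, A i ∩ S = {x}) ↔ ∃ x, A' i ∩ S' = {x}) ∧
      (∀ i j, (∃ x y, A i ∩ S = {x} ∧ A j ∩ S = {y} ∧ x < y) ↔
        ∃ x y, A' i ∩ S' = {x} ∧ A' j ∩ S' = {y} ∧ x < y) ∧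
      ∀ i j, A i ∩ S ⊆ A j ↔ A' i ∩ S' ⊆ A' j := by
  unfold ty
  refine Prod.mk_inj.trans (and_congr ?_ (Prod.mk_inj.trans (and_congr ?_
    (Prod.mk_inj.trans (and_congr ?_ ?_))))) <;>
  simp only [funext_iff, eq_iff_iff]

theorem ty_congr {S : Set C} (n : ℕ) : ∀ {l : ℕ} {A A' : Fin l → Set C},
    (∀ i, A i ∩ S = A' i ∩ S) → ty S n A = ty S n A' := by
  induction n with
  | zero =>
    intro l A A' h
    have hs : ∀ i j, A i ∩ S ⊆ A j ↔ A' i ∩ S ⊆ A' j := fun i j => by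
      have h1 : ∀ B D : Set C, B ∩ S ⊆ D ↔ B ∩ S ⊆ D ∩ S := fun B D => by simp
      rw [h1, h1 (A' i), h, h]
    refine ty_zero_eq_iff.2 ⟨fun i => by rw [h], fun i => by rw [h], fun i j => by rw [h, h], hs⟩
  | succ n ih =>
    intro l A A' h
    refine Set.ext fun t => exists_congr fun B => ?_
    rw [ih (A := append A B) (A' := append A' B)]
    intro i
    induction i using Fin.lastCases with
    | last => simp
    | cast i => simpa using h i

theorem exists_ty_eq {C' : Type*} [LinearOrder C'] {S : Set C} {S' : Set C'} {n l : ℕ}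
    {A : Fin l → Set C} {A' : Fin l → Set C'}
    (h : ty S (n + 1) A = ty S' (n + 1) A') (B : Set C) :
    ∃ B' : Set C', ty S n (append A B) = ty S' n (append A' B') := by
  have hB : ty S n (append A B) ∈
      ({t | ∃ B : Set C, t = ty S n (append A B)} : Set (TypeVal n (l + 1))) := ⟨B, rfl⟩
  have h' : ({t | ∃ B : Set C, t = ty S n (append A B)} : Set (TypeVal n (l + 1))) =
    {t | ∃ B : Set C', t = ty S' n (append A' B)} := h
  rw [h'] at hB
  exact hB

/-- Emptiness is part of the atomic type, and higher types refine it: padding the tuple by `∅`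
lowers the level by one. This is what finally distinguishes the moved set from the original. -/
theorem inter_nonempty_of_ty_eq (n : ℕ) {S S' : Set C} : ∀ {l : ℕ} {A A' : Fin l → Set C},
    ty S n A = ty S' n A' → ∀ i, (A i ∩ S).Nonempty → (A' i ∩ S').Nonempty := by
  induction n with
  | zero =>
    intro l A A' h i hi
    rw [Set.nonempty_iff_ne_empty] at hi ⊢
    rwa [Ne, ← (ty_zero_eq_iff.1 h).1 i]
  | succ n ih =>
    intro l A A' h i hi
    obtain ⟨B', hB'⟩ := exists_ty_eq h ∅
    simpa using ih hB' i.castSucc (by simpa using hi)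

theorem ty_comp (n : ℕ) {S S' : Set C} : ∀ {k l : ℕ} {A A' : Fin l → Set C} (σ : Fin k → Fin l),
    ty S n A = ty S' n A' → ty S n (A ∘ σ) = ty S' n (A' ∘ σ) := by
  induction n with
  | zero =>
    intro k l A A' σ h
    obtain ⟨h0, h1, h2, h3⟩ := ty_zero_eq_iff.1 h
    exact ty_zero_eq_iff.2 ⟨fun i => h0 _, fun i => h1 _, fun i j => h2 _ _, fun i j => h3 _ _⟩
  | succ n ih =>
    intro k l A A' σ h
    -- The reindexing is extended by sending the newly bound last variable to the last variable.
    have key : ∀ (B : Fin l → Set C) (D : Set C), append (B ∘ σ) D =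
        append B D ∘ (Fin.snoc (α := fun _ => Fin (l + 1)) (fun i => (σ i).castSucc)
          (Fin.last l)) := by
      intro B D
      funext i
      induction i using Fin.lastCases with
      | last => simp
      | cast i => simp
    refine Set.ext fun t => ?_
    constructor
    · rintro ⟨B, rfl⟩
      obtain ⟨B', hB'⟩ := exists_ty_eq h B
      exact ⟨B', by rw [key, key]; exact ih _ hB'⟩
    · rintro ⟨B, rfl⟩
      obtain ⟨B', hB'⟩ := exists_ty_eq h.symm B
      exact ⟨B', by rw [key, key]; exact (ih _ hB'.symm).symm⟩

theorem sat_iff_of_ty_zero_eq {l : ℕ} {A A' : Fin l → Set C}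
    (h : ty Set.univ 0 A = ty Set.univ 0 A') (φ : Formula l) (hφ : φ.qdepth = 0) :
    Sat C φ A ↔ Sat C φ A' := by
  obtain ⟨-, h1, h2, h3⟩ := ty_zero_eq_iff.1 h
  clear h
  simp only [Set.inter_univ] at h1 h2 h3
  induction φ with
  | sing i => exact h1 i
  | lt i j => exact h2 i j
  | sub i j => exact h3 i j
  | neg φ ih => exact not_congr (ih hφ h1 h2 h3)
  | and φ ψ ih₁ ih₂ =>
    simp only [Formula.qdepth, Nat.max_eq_zero_iff] at hφ
    exact and_congr (ih₁ hφ.1 h1 h2 h3) (ih₂ hφ.2 h1 h2 h3)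
  | ex φ => simp [Formula.qdepth] at hφ

/-- Atomic facts determine all quantifier-free formulas, and the higher levels of `Th` and `ty` are
built by the same recursion. -/
theorem Th_eq_of_ty_eq (n : ℕ) : ∀ {l : ℕ} {A A' : Fin l → Set C},
    ty Set.univ n A = ty Set.univ n A' → Th C n A = Th C n A' := by
  induction n with
  | zero =>
    intro l A A' h
    exact Set.ext fun φ => and_congr_right fun hφ => sat_iff_of_ty_zero_eq h φ hφ
  | succ n ih =>
    intro l A A' h
    refine Set.ext fun t => ?_
    constructor
    · rintro ⟨B, rfl⟩
      obtain ⟨B', hB'⟩ := exists_ty_eq h B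
      exact ⟨B', ih hB'⟩
    · rintro ⟨B, rfl⟩
      obtain ⟨B', hB'⟩ := exists_ty_eq h.symm B
      exact ⟨B', ih hB'⟩

theorem Prec.disjoint {S T : Set C} (h : Prec S T) : Disjoint S T :=
  Set.disjoint_left.2 fun x hx hx' => lt_irrefl x (h x hx x hx')

theorem exists_glue {C I : Type*} {S : I → Set C} (hS : Pairwise fun a b => Disjoint (S a) (S b))
    (B : I → Set C) : ∃ B' : Set C, ∀ a, B' ∩ S a = B a ∩ S a := by
  refine ⟨⋃ a, B a ∩ S a, fun a => Set.ext fun x => ?_⟩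
  simp only [Set.mem_inter_iff, Set.mem_iUnion]
  constructor
  · rintro ⟨⟨b, hb, hb'⟩, ha⟩
    have hab : b = a := by
      by_contra hne
      exact Set.disjoint_left.1 (hS hne) hb' ha
    exact ⟨hab ▸ hb, ha⟩
  · exact fun h => ⟨⟨a, h⟩, h.2⟩

/-- A set is a singleton in a sum when it is a singleton in one summand and empty in the others;
hence atomic types must record emptiness as well. -/
theorem inter_iUnion_eq_singleton_iff {C I : Type*} {S : I → Set C}
    (hS : Pairwise fun a b => Disjoint (S a) (S b)) {X : Set C} {x : C} :
    X ∩ ⋃ a, S a = {x} ↔ ∃ a, X ∩ S a = {x} ∧ ∀ b ≠ a, X ∩ S b = ∅ := by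
  constructor
  · intro h
    have hx : x ∈ X ∩ ⋃ a, S a := h ▸ rfl
    obtain ⟨hX, hx⟩ := hx
    obtain ⟨a, ha⟩ := Set.mem_iUnion.1 hx
    have hu : ∀ b, ∀ y ∈ X ∩ S b, y = x := fun b y hy => by
      have : y ∈ X ∩ ⋃ a, S a := ⟨hy.1, Set.mem_iUnion.2 ⟨b, hy.2⟩⟩
      rwa [h] at this
    refine ⟨a, Set.eq_singleton_iff_unique_mem.2 ⟨⟨hX, ha⟩, hu a⟩, fun b hb => ?_⟩
    refine Set.eq_empty_of_forall_notMem fun y hy => ?_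
    rw [hu b y hy] at hy
    exact Set.disjoint_left.1 (hS hb) hy.2 ha
  · rintro ⟨a, ha, hb⟩
    have hx : x ∈ X ∩ S a := ha ▸ rfl
    refine Set.eq_singleton_iff_unique_mem.2 ⟨⟨hx.1, Set.mem_iUnion.2 ⟨a, hx.2⟩⟩, ?_⟩
    rintro y ⟨hy, hy'⟩
    obtain ⟨b, hyb⟩ := Set.mem_iUnion.1 hy'
    by_cases hba : b = a
    · subst hba
      have : y ∈ X ∩ S b := ⟨hy, hyb⟩
      rwa [ha] at this
    · have : y ∈ X ∩ S b := ⟨hy, hyb⟩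
      rw [hb b hba] at this
      exact this.elim

theorem pairwise_disjoint_of_prec {I : Type*} [LinearOrder I] {S : I → Set C}
    (hS : ∀ a b, a < b → Prec (S a) (S b)) : Pairwise fun a b => Disjoint (S a) (S b) := by
  intro a b hab
  rcases lt_or_gt_of_ne hab with h | h
  · exact (hS a b h).disjoint
  · exact (hS b a h).disjoint.symm

/-- The composition theorem for ordered sums. -/
theorem ty_iUnion {I : Type*} [LinearOrder I] {S : I → Set C}
    (hS : ∀ a b, a < b → Prec (S a) (S b)) (n : ℕ) : ∀ {l : ℕ} (A : Fin l → Set C),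
    ty (⋃ a, S a) n A = sumType n fun a => ty (S a) n A := by
  have hd := pairwise_disjoint_of_prec hS
  induction n with
  | zero =>
    intro l A
    have h1 : ∀ i, (∃ x, A i ∩ ⋃ a, S a = {x}) ↔
        ∃ a, (∃ x, A i ∩ S a = {x}) ∧ ∀ c ≠ a, A i ∩ S c = ∅ := fun i => by
      simp only [inter_iUnion_eq_singleton_iff hd]
      exact ⟨fun ⟨x, a, h, h'⟩ => ⟨a, ⟨x, h⟩, h'⟩, fun ⟨a, ⟨x, h⟩, h'⟩ => ⟨x, a, h, h'⟩⟩
    refine Prod.ext (funext fun i => ?_) (Prod.ext (funext fun i => ?_)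
      (Prod.ext (funext fun i => funext fun j => ?_) (funext fun i => funext fun j => ?_))) <;>
      refine propext ?_
    · change A i ∩ ⋃ a, S a = ∅ ↔ ∀ a, A i ∩ S a = ∅
      simp [Set.inter_iUnion]
    · exact h1 i
    · simp only [ty, inter_iUnion_eq_singleton_iff hd]
      constructor
      · rintro ⟨x, y, ⟨a, ha, ha'⟩, ⟨b, hb, hb'⟩, hxy⟩
        refine ⟨a, b, ⟨⟨x, ha⟩, ha'⟩, ⟨⟨y, hb⟩, hb'⟩, ?_⟩
        rcases lt_trichotomy a b with h | h | h
        · exact Or.inl h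
        · subst h
          exact Or.inr ⟨rfl, x, y, ha, hb, hxy⟩
        · have hx : x ∈ A i ∩ S a := ha ▸ rfl
          have hy : y ∈ A j ∩ S b := hb ▸ rfl
          exact absurd hxy (hS b a h y hy.2 x hx.2).not_gt
      · rintro ⟨a, b, ⟨⟨x, ha⟩, ha'⟩, ⟨⟨y, hb⟩, hb'⟩, h⟩
        rcases h with h | ⟨rfl, x, y, hx, hy, h⟩
        · have hx : x ∈ A i ∩ S a := ha ▸ rfl
          have hy : y ∈ A j ∩ S b := hb ▸ rfl
          exact ⟨x, y, ⟨a, ha, ha'⟩, ⟨b, hb, hb'⟩, hS a b h x hx.2 y hy.2⟩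
        · exact ⟨x, y, ⟨a, hx, ha'⟩, ⟨a, hy, hb'⟩, h⟩
    · change A i ∩ ⋃ a, S a ⊆ A j ↔ ∀ a, A i ∩ S a ⊆ A j
      simp [Set.inter_iUnion]
  | succ n ih =>
    intro l A
    refine Set.ext fun t => ?_
    constructor
    · rintro ⟨B, rfl⟩
      exact ⟨fun a => ty (S a) n (append A B), fun a => ⟨B, rfl⟩, ih _⟩
    · rintro ⟨g, hg, rfl⟩
      -- Witnesses chosen separately on the summands are glued to one subset, since the summands are
      -- disjoint and types see only traces.
      choose B hB using hg
      obtain ⟨B', hB'⟩ := exists_glue hd B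
      refine ⟨B', ?_⟩
      rw [ih]
      congr 1
      funext a
      rw [hB a]
      refine ty_congr n fun i => ?_
      induction i using Fin.lastCases with
      | last => simpa using (hB' a).symm
      | cast i => simp

/-- The type of a sum of two summands. -/
def addType {n l : ℕ} (s t : TypeVal n l) : TypeVal n l :=
  sumType n fun b : Bool => cond b t s

/-- The type of a sum of `ω` many summands of the same type. -/
def omegaType {n l : ℕ} (t : TypeVal n l) : TypeVal n l :=
  sumType n fun _ : ℕ => t

theorem ty_union {S T : Set C} (h : Prec S T) (n : ℕ) {l : ℕ} (A : Fin l → Set C) :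
    ty (S ∪ T) n A = addType (ty S n A) (ty T n A) := by
  have h1 : S ∪ T = ⋃ b : Bool, cond b T S := by
    rw [Set.union_comm]; exact Set.union_eq_iUnion
  rw [h1, ty_iUnion]
  · unfold addType
    congr 1
    funext b
    cases b <;> rfl
  · intro a b hab
    cases a <;> cases b <;> first | exact h | exact absurd hab (by decide)

theorem ty_iUnion_nat {S : ℕ → Set C} (hS : ∀ i j, i < j → Prec (S i) (S j)) {n l : ℕ}
    {A : Fin l → Set C} {t : TypeVal n l} (ht : ∀ i, ty (S i) n A = t) :
    ty (⋃ i, S i) n A = omegaType t := by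
  rw [ty_iUnion hS]
  simp only [ht]
  rfl

end Types

/-- Ramsey's theorem for pairs of natural numbers. -/
theorem exists_strictMono_forall_lt_eq {K : Type*} [Finite K] (c : ℕ → ℕ → K) :
    ∃ g : ℕ → ℕ, StrictMono g ∧ ∃ k, ∀ i j, i < j → c (g i) (g j) = k := by
  classical
  -- A nonprincipal ultrafilter gives each `i` a limit colour `k i`, and these a limit colour `k0`.
  -- The sequence is then built greedily: each new index is joined by colour `k0` to all earlier
  -- ones and has limit colour `k0` itself.
  have hfin (f : ℕ → K) : ∃ k, ∀ᶠ i in (Filter.hyperfilter ℕ : Filter ℕ), f i = k :=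
    Ultrafilter.eventually_exists_iff.1 (Filter.Eventually.of_forall fun i => ⟨f i, rfl⟩)
  choose k hk using fun i => hfin (c i)
  obtain ⟨k0, hk0⟩ := hfin k
  obtain ⟨g, -, hg⟩ := exists_seq_of_forall_finset_exists (fun i => k i = k0)
    (fun i j => i < j ∧ c i j = k0) (fun s hs => by
      have h2 : ∀ᶠ j in (Filter.hyperfilter ℕ : Filter ℕ), ∀ i ∈ s, i < j ∧ c i j = k0 := by
        rw [Filter.eventually_all_finset]
        intro i hi
        have h3 : ∀ᶠ j in (Filter.hyperfilter ℕ : Filter ℕ), i < j :=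
          (Filter.eventually_gt_atTop i).filter_mono
            ((Filter.hyperfilter_le_cofinite).trans_eq Nat.cofinite_eq_atTop)
        filter_upwards [h3, hk i] with j hj hj'
        exact ⟨hj, hj'.trans (hs i hi)⟩
      exact (hk0.and h2).exists)
  exact ⟨g, fun i j hij => (hg i j hij).1, k0, fun i j hij => (hg i j hij).2⟩

end MSO
namespace MSO

/-! ### Ordered families of sets, their heads and tails. -/

section Prec

variable {C : Type*} [LinearOrder C]

theorem prec_union_left {S S' T : Set C} : Prec (S ∪ S') T ↔ Prec S T ∧ Prec S' T :=
  ⟨fun h => ⟨fun x hx => h x (Or.inl hx), fun x hx => h x (Or.inr hx)⟩,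
    fun h x hx => hx.elim (h.1 x) (h.2 x)⟩

theorem prec_union_right {S T T' : Set C} : Prec S (T ∪ T') ↔ Prec S T ∧ Prec S T' :=
  ⟨fun h => ⟨fun x hx y hy => h x hx y (Or.inl hy), fun x hx y hy => h x hx y (Or.inr hy)⟩,
    fun h x hx y hy => hy.elim (h.1 x hx y) (h.2 x hx y)⟩

theorem Prec.mono {S S' T T' : Set C} (h : Prec S T) (hS : S' ⊆ S) (hT : T' ⊆ T) : Prec S' T' :=
  fun x hx y hy => h x (hS hx) y (hT hy)

theorem Prec.trans {S T U : Set C} (h : Prec S T) (h' : Prec T U) (hT : T.Nonempty) :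
    Prec S U := fun x hx y hy => by
  obtain ⟨z, hz⟩ := hT
  exact (h x hx z hz).trans (h' z hz y hy)

/-- The union of the members of the sequence `V` of index less than `i`. -/
def headUnion {C : Type*} (V : ℕ → Set C) (i : ℕ) : Set C := {x | ∃ k < i, x ∈ V k}

/-- The union of the members of the sequence `V` of index at least `i`. -/
def tailUnion {C : Type*} (V : ℕ → Set C) (i : ℕ) : Set C := ⋃ k, V (i + k)

theorem subset_tailUnion {C : Type*} {V : ℕ → Set C} {i j : ℕ} (hij : i ≤ j) :
    V j ⊆ tailUnion V i := fun x hx =>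
  Set.mem_iUnion.2 ⟨j - i, by rwa [Nat.add_sub_cancel' hij]⟩

theorem tailUnion_eq {C : Type*} (V : ℕ → Set C) (i : ℕ) :
    tailUnion V i = V i ∪ tailUnion V (i + 1) := by
  ext x
  simp only [tailUnion, Set.mem_union, Set.mem_iUnion]
  constructor
  · rintro ⟨_ | k, hk⟩
    · exact Or.inl hk
    · exact Or.inr ⟨k, by rwa [add_right_comm]⟩
  · rintro (hk | ⟨k, hk⟩)
    · exact ⟨0, hk⟩
    · exact ⟨k + 1, by rwa [add_right_comm] at hk⟩

theorem iUnion_eq_headUnion_union_tailUnion {C : Type*} (V : ℕ → Set C) (i : ℕ) :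
    ⋃ k, V k = headUnion V i ∪ tailUnion V i := by
  refine Set.Subset.antisymm (Set.iUnion_subset fun k => ?_) (Set.union_subset ?_ ?_)
  · rcases lt_or_ge k i with h | h
    · exact fun x hx => Or.inl ⟨k, h, hx⟩
    · exact (subset_tailUnion h).trans Set.subset_union_right
  · rintro x ⟨k, -, hx⟩
    exact Set.mem_iUnion.2 ⟨k, hx⟩
  · exact Set.iUnion_subset fun k => Set.subset_iUnion V (i + k)

variable {V : ℕ → Set C} (hV : ∀ i j, i < j → Prec (V i) (V j))

include hV

theorem prec_tailUnion {i j : ℕ} (hij : i < j) : Prec (V i) (tailUnion V j) := fun x hx y hy => by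
  obtain ⟨k, hk⟩ := Set.mem_iUnion.1 hy
  exact hV i (j + k) (by omega) x hx y hk

theorem headUnion_prec_tailUnion (i : ℕ) : Prec (headUnion V i) (tailUnion V i) := by
  rintro x ⟨k, hk, hx⟩ y hy
  exact prec_tailUnion hV hk x hx y hy

theorem ty_tailUnion {n l : ℕ} {A : Fin l → Set C} {u : TypeVal n l}
    (hu : ∀ i, ty (V i) n A = u) (i : ℕ) : ty (tailUnion V i) n A = omegaType u :=
  ty_iUnion_nat (fun a b hab => hV _ _ (by omega)) fun _ => hu _

/-- Absorption, `1 + ω = ω`: splitting off the first summand leaves a tail of the same type as the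
whole sum. -/
theorem addType_omegaType {n l : ℕ} {A : Fin l → Set C} {u : TypeVal n l}
    (hu : ∀ i, ty (V i) n A = u) : addType u (omegaType u) = omegaType u := by
  rw [← ty_tailUnion hV hu 0]
  nth_rewrite 2 [tailUnion_eq]
  rw [ty_union (prec_tailUnion hV (Nat.lt_succ_self 0)), hu, ty_tailUnion hV hu,
    ty_tailUnion hV hu]

end Prec

/-! ### Blocks with types depending only on rank. -/

section Good

variable {C : Type*} [LinearOrder C] {N l : ℕ}

/-- `S` contains a sum of `ω ^ r` many points. -/
def Rich : ℕ → Set C → Prop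
  | 0, S => S.Nonempty
  | r + 1, S => ∃ f : ℕ → Set C, (∀ i j, i < j → Prec (f i) (f j)) ∧ ∀ i, f i ⊆ S ∧ Rich r (f i)

/-- `D` is a block of rank `r` for `Y`: a convex set which is an `ω`-sum of blocks of
rank `r - 1`, separated by gaps free of `Y`, such that the type of a block or gap depends on its
rank only. -/
def Good (P : Fin l → Set C) (Y : Set C) (t h : ℕ → TypeVal N (l + 1)) : ℕ → Set C → Prop
  | 0, D => D.OrdConnected ∧ (Y ∩ D).Nonempty ∧ ty D N (Matrix.vecCons Y P) = t 0
  | r + 1, D => D.OrdConnected ∧ ty D N (Matrix.vecCons Y P) = t (r + 1) ∧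
    ∃ E H : ℕ → Set C, (∀ i, Prec (E i) (H i)) ∧
      (∀ i j, i < j → Prec (E i ∪ H i) (E j ∪ H j)) ∧ D = ⋃ i, (E i ∪ H i) ∧
      ∀ i, Good P Y t h r (E i) ∧ Y ∩ H i = ∅ ∧ ty (H i) N (Matrix.vecCons Y P) = h r

variable {P : Fin l → Set C} {Y Y' : Set C} {t h t' h' : ℕ → TypeVal N (l + 1)}

theorem Good.ordConnected : ∀ {r : ℕ} {D : Set C}, Good P Y t h r D → D.OrdConnected
  | 0, _, hD => hD.1
  | _ + 1, _, hD => hD.1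

theorem Good.ty_eq : ∀ {r : ℕ} {D : Set C}, Good P Y t h r D →
    ty D N (Matrix.vecCons Y P) = t r
  | 0, _, hD => hD.2.2
  | _ + 1, _, hD => hD.2.1

theorem Good.nonempty : ∀ {r : ℕ} {D : Set C}, Good P Y t h r D → (Y ∩ D).Nonempty
  | 0, _, hD => hD.2.1
  | r + 1, _, hD => by
    obtain ⟨-, -, E, H, -, -, rfl, hE⟩ := hD
    obtain ⟨x, hx, hx'⟩ := (hE 0).1.nonempty
    exact ⟨x, hx, Set.mem_iUnion.2 ⟨0, Or.inl hx'⟩⟩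

theorem ty_vecCons_congr {S : Set C} (hY : Y ∩ S = Y' ∩ S) :
    ty S N (Matrix.vecCons Y P) = ty S N (Matrix.vecCons Y' P) := by
  refine ty_congr N fun i => ?_
  induction i using Fin.cases with
  | zero => simpa using hY
  | succ i => simp

/-- A block of rank `r` involves only the trace of `Y` on it, block types up to rank `r` and gap
types below rank `r`; everything else may be altered freely. -/
theorem Good.congr {r : ℕ} : ∀ {D : Set C}, Good P Y t h r D → Y ∩ D = Y' ∩ D →
    (∀ k ≤ r, t k = t' k) → (∀ k < r, h k = h' k) → Good P Y' t' h' r D := by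
  induction r with
  | zero =>
    intro D hD hY ht hh
    exact ⟨hD.1, hY ▸ hD.2.1, by rw [← ty_vecCons_congr hY, hD.2.2, ht 0 le_rfl]⟩
  | succ r ih =>
    intro D hD hY ht hh
    refine ⟨hD.1, by rw [← ty_vecCons_congr hY, hD.2.1, ht _ le_rfl], ?_⟩
    obtain ⟨-, -, E, H, hEH, hV, rfl, hE⟩ := hD
    refine ⟨E, H, hEH, hV, rfl, fun i => ?_⟩
    have hS : ∀ S : Set C, S ⊆ ⋃ i, (E i ∪ H i) → Y ∩ S = Y' ∩ S := fun S hS => by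
      rw [← Set.inter_eq_self_of_subset_right hS, ← Set.inter_assoc, hY, Set.inter_assoc]
    have h1 := hS (E i) (Set.subset_union_left.trans (Set.subset_iUnion (fun i => E i ∪ H i) i))
    have h2 := hS (H i) (Set.subset_union_right.trans (Set.subset_iUnion (fun i => E i ∪ H i) i))
    exact ⟨ih (hE i).1 h1 (fun k hk => ht k (by omega)) (fun k hk => hh k (by omega)),
      h2 ▸ (hE i).2.1, by rw [← ty_vecCons_congr h2, (hE i).2.2, hh r (by omega)]⟩

theorem Good.exists_subset {r s : ℕ} (hrs : r ≤ s) : ∀ {D : Set C}, Good P Y t h s D →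
    ∃ D' ⊆ D, Good P Y t h r D' := by
  induction s, hrs using Nat.le_induction with
  | base => exact fun {D} hD => ⟨D, subset_rfl, hD⟩
  | succ s _ ih =>
    rintro _ ⟨-, -, E, H, -, -, rfl, hE⟩
    obtain ⟨D', hD', hG⟩ := ih (hE 0).1
    exact ⟨D', hD'.trans (Set.subset_union_left.trans
      (Set.subset_iUnion (fun i => E i ∪ H i) 0)), hG⟩

/-- In a sequence of convex sets and the gaps between them, unions are ordered. -/
theorem prec_union_gap {E H : ℕ → Set C} (hne : ∀ i, (E i).Nonempty)
    (hE : ∀ i j, i < j → Prec (E i) (E j)) (hEH : ∀ i, Prec (E i) (H i))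
    (hHE : ∀ i, Prec (H i) (E (i + 1))) (i j : ℕ) (hij : i < j) :
    Prec (E i ∪ H i) (E j ∪ H j) := by
  have h1 : Prec (H i) (E j) := by
    rcases (Nat.succ_le_of_lt hij).eq_or_lt with rfl | h
    · exact hHE i
    · exact (hHE i).trans (hE _ _ h) (hne _)
  simp only [prec_union_left, prec_union_right]
  exact ⟨⟨hE i j hij, h1⟩, (hE i j hij).trans (hEH j) (hne j), h1.trans (hEH j) (hne j)⟩

theorem ordConnected_iUnion_union_gap {E H : ℕ → Set C} (hc : ∀ i, (E i).OrdConnected)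
    (hne : ∀ i, (E i).Nonempty)
    (hV : ∀ i j, i < j → Prec (E i ∪ H i) (E j ∪ H j)) (hEH : ∀ i, Prec (E i) (H i))
    (hH : ∀ i x, (∀ d ∈ E i, d < x) → (∀ d ∈ E (i + 1), x < d) → x ∈ H i) :
    (⋃ i, (E i ∪ H i)).OrdConnected := by
  refine ⟨fun x hx y hy z hz => ?_⟩
  obtain ⟨i, hi⟩ := Set.mem_iUnion.1 hx
  obtain ⟨j, hj⟩ := Set.mem_iUnion.1 hy
  obtain ⟨d, hd, hdz⟩ : ∃ d ∈ E i, d ≤ z := by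
    rcases hi with hi | hi
    · exact ⟨x, hi, hz.1⟩
    · obtain ⟨d, hd⟩ := hne i
      exact ⟨d, hd, (hEH i d hd x hi).le.trans hz.1⟩
  -- Induction on how many components past `E i` are needed to reach above `z`: a point above all of
  -- one component and below all of the next lies in the gap.
  have key : ∀ k, (∃ e ∈ E (i + k), z ≤ e) → z ∈ ⋃ i, (E i ∪ H i) := by
    intro k
    induction k with
    | zero =>
      rintro ⟨e, he, hze⟩
      exact Set.mem_iUnion.2 ⟨i, Or.inl ((hc i).out hd he ⟨hdz, hze⟩)⟩
    | succ k ih =>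
      rintro ⟨e, he, hze⟩
      by_cases h1 : ∃ e ∈ E (i + k), z ≤ e
      · exact ih h1
      push Not at h1
      by_cases h2 : ∃ e ∈ E (i + (k + 1)), e ≤ z
      · obtain ⟨e', he', hez⟩ := h2
        exact Set.mem_iUnion.2 ⟨_, Or.inl ((hc _).out he' he ⟨hez, hze⟩)⟩
      · push Not at h2
        exact Set.mem_iUnion.2 ⟨i + k, Or.inr (hH _ z h1 h2)⟩
  obtain ⟨e, he⟩ := hne (i + (j + 1))
  exact key (j + 1) ⟨e, he, hz.2.trans (hV j _ (by omega) y hj e (Or.inl he)).le⟩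

/-- Blocks of rank `r` found in the successive pieces of `S` are thinned by Ramsey's theorem until
their type data agree. That the block lies in the convex hull of `S` keeps blocks from successive
pieces in order. -/
theorem Rich.exists_good (P : Fin l → Set C) (N : ℕ) (r : ℕ) : ∀ {S : Set C}, Rich r S →
    ∃ (D Y : Set C) (t h : ℕ → TypeVal N (l + 1)),
      (∀ x ∈ D, ∃ a ∈ S, ∃ b ∈ S, a ≤ x ∧ x ≤ b) ∧ Y ⊆ D ∧ Good P Y t h r D := by
  induction r with
  | zero =>
    rintro S ⟨a, ha⟩
    refine ⟨{a}, {a}, fun _ => ty {a} N (Matrix.vecCons {a} P),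
      fun _ => ty {a} N (Matrix.vecCons {a} P), ?_, subset_rfl, Set.ordConnected_singleton, ?_, rfl⟩
    · rintro x rfl
      exact ⟨x, ha, x, ha, le_rfl, le_rfl⟩
    · simp
  | succ r ih =>
    rintro S ⟨f, hf, hfS⟩
    choose D Y t h hDS hYD hG using fun i => ih (hfS i).2
    have hD : ∀ i j, i < j → Prec (D i) (D j) := fun i j hij x hx y hy => by
      obtain ⟨-, -, b, hb, -, hxb⟩ := hDS i x hx
      obtain ⟨a, ha, -, -, hay, -⟩ := hDS j y hy
      exact hxb.trans_lt ((hf i j hij b hb a ha).trans_le hay)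
    have hne : ∀ i, (D i).Nonempty := fun i => (hG i).nonempty.mono Set.inter_subset_right
    -- The gap between two chosen blocks swallows the discarded ones, so its type depends on a pair
    -- of indices; this is why Ramsey's theorem for pairs is needed. `Y` will be empty there, whence
    -- `∅` in the colouring.
    let gap : ℕ → ℕ → Set C := fun i j => {x | (∀ d ∈ D i, d < x) ∧ ∀ d ∈ D j, x < d}
    obtain ⟨g, hg, ⟨k₁, k₂⟩, hk⟩ := exists_strictMono_forall_lt_eq
      (K := (Fin (r + 1) → TypeVal N (l + 1) × TypeVal N (l + 1)) × TypeVal N (l + 1))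
      fun i j => (fun k => (t i k, h i k), ty (gap i j) N (Matrix.vecCons ∅ P))
    simp only [Prod.mk.injEq] at hk
    have hth : ∀ i, ∀ k ≤ r, t (g i) k = t (g 0) k ∧ h (g i) k = h (g 0) k := fun i k hik => by
      have h1 := congrFun ((hk i (i + 1) (by omega)).1.trans (hk 0 1 (by omega)).1.symm)
        ⟨k, by omega⟩
      simpa using h1
    let E : ℕ → Set C := fun i => D (g i)
    let H : ℕ → Set C := fun i => gap (g i) (g (i + 1))
    let Y' : Set C := ⋃ i, Y (g i)
    have hE : ∀ i j, i < j → Prec (E i) (E j) := fun i j hij => hD _ _ (hg hij)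
    have hEH : ∀ i, Prec (E i) (H i) := fun i x hx y hy => hy.1 x hx
    have hHE : ∀ i, Prec (H i) (E (i + 1)) := fun i x hx y hy => hx.2 y hy
    have hV := prec_union_gap (fun i => hne (g i)) hE hEH hHE
    have hYE : ∀ i, Y' ∩ E i = Y (g i) ∩ E i := fun i => by
      ext x
      refine ⟨fun ⟨hx, hxE⟩ => ⟨?_, hxE⟩, fun hx => ⟨Set.mem_iUnion.2 ⟨i, hx.1⟩, hx.2⟩⟩
      obtain ⟨j, hj⟩ := Set.mem_iUnion.1 hx
      rcases lt_trichotomy i j with hij | rfl | hij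
      · exact absurd (hE i j hij x hxE x (hYD _ hj)) (lt_irrefl x)
      · exact hj
      · exact absurd (hE j i hij x (hYD _ hj) x hxE) (lt_irrefl x)
    have hYH : ∀ i, Y' ∩ H i = ∅ := fun i => by
      refine Set.eq_empty_of_forall_notMem ?_
      rintro x ⟨hx, hxH⟩
      obtain ⟨j, hj⟩ := Set.mem_iUnion.1 hx
      have hj' : x ∈ E j := hYD _ hj
      rcases lt_trichotomy i j with hij | rfl | hij
      · exact lt_irrefl x (hV i j hij x (Or.inr hxH) x (Or.inl hj'))
      · exact lt_irrefl x (hEH i x hj' x hxH)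
      · exact lt_irrefl x (hV j i hij x (Or.inl hj') x (Or.inr hxH))
    let D' : Set C := ⋃ i, (E i ∪ H i)
    -- The new data are the block type at rank `r + 1` and the gap type at rank `r`; lower values
    -- are those of the homogeneous sequence, and the remaining values are arbitrary.
    refine ⟨D', Y', fun k => if k ≤ r then t (g 0) k else ty D' N (Matrix.vecCons Y' P),
      fun k => if k < r then h (g 0) k else k₂, ?_, ?_, ?_, ?_, E, H, hEH, hV, rfl, fun i =>
        ⟨(hG (g i)).congr (hYE i).symm ?_ ?_, hYH i, ?_⟩⟩
    · intro x hx
      obtain ⟨i, hi⟩ := Set.mem_iUnion.1 hx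
      obtain ⟨d, hd, hdx⟩ : ∃ d ∈ E i, d ≤ x := by
        rcases hi with hi | hi
        · exact ⟨x, hi, le_rfl⟩
        · obtain ⟨d, hd⟩ := hne (g i)
          exact ⟨d, hd, (hi.1 d hd).le⟩
      obtain ⟨e, he⟩ := hne (g (i + 1))
      have hxe := hV i (i + 1) (by omega) x hi e (Or.inl he)
      obtain ⟨a, ha, -, -, had, -⟩ := hDS _ d hd
      obtain ⟨-, -, b, hb, -, heb⟩ := hDS _ e he
      exact ⟨a, (hfS _).1 ha, b, (hfS _).1 hb, had.trans hdx, hxe.le.trans heb⟩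
    · exact Set.iUnion_subset fun i => (hYD (g i)).trans (Set.subset_union_left.trans
        (Set.subset_iUnion (fun i => E i ∪ H i) i))
    · exact ordConnected_iUnion_union_gap (fun i => (hG _).ordConnected) (fun i => hne (g i)) hV hEH
        fun i x h1 h2 => ⟨h1, h2⟩
    · simp
    · intro k hk
      simp [hk, (hth i k hk).1]
    · intro k hk
      simp [hk, (hth i k hk.le).2]
    · have h1 : Y' ∩ H i = ∅ ∩ H i := by simp [hYH i]
      rw [ty_vecCons_congr h1]
      simpa using (hk i (i + 1) (by omega)).2

/-- Descending to the block of rank `r + 1` around `p`, all that follows the component of `p` is a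
gap and then a tail of an `ω`-sum, which has the type of the full block. On the way back up, the
final piece takes in the remaining gap and tail at each rank, and absorption restores the type of
the larger block. -/
theorem Good.exists_cut {r s : ℕ} (hrs : r + 1 ≤ s) : ∀ {D : Set C} {p : C}, Good P Y t h s D →
    p ∈ Y → p ∈ D → ∃ L G B E G' Z : Set C, [L, G, B, E, G', Z].Pairwise Prec ∧
      D = L ∪ (G ∪ (B ∪ (E ∪ (G' ∪ Z)))) ∧ p ∈ L ∧
      ty G N (Matrix.vecCons Y P) = h r ∧ ty B N (Matrix.vecCons Y P) = addType (t r) (h r) ∧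
      ty E N (Matrix.vecCons Y P) = t r ∧ ty G' N (Matrix.vecCons Y P) = h r ∧
      ty Z N (Matrix.vecCons Y P) = t s ∧
      ty (B ∪ (E ∪ (G' ∪ Z))) N (Matrix.vecCons Y P) = t s := by
  induction s, hrs using Nat.le_induction with
  | base =>
    rintro D p ⟨-, hty, E, H, hEH, hV, rfl, hE⟩ hpY hpD
    obtain ⟨i, hi⟩ := Set.mem_iUnion.1 hpD
    replace hi : p ∈ E i := hi.resolve_right fun hp => by
      have : p ∈ Y ∩ H i := ⟨hpY, hp⟩
      rw [(hE i).2.1] at this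
      exact this
    let V : ℕ → Set C := fun i => E i ∪ H i
    have hu : ∀ i, ty (V i) N (Matrix.vecCons Y P) = addType (t r) (h r) := fun i => by
      rw [ty_union (hEH i), (hE i).1.ty_eq, (hE i).2.2]
    have ht : omegaType (addType (t r) (h r)) = t (r + 1) := by
      rw [← hty, ty_iUnion_nat hV hu]
    have hT : V (i + 1) ∪ (E (i + 2) ∪ (H (i + 2) ∪ tailUnion V (i + 3))) =
        tailUnion V (i + 1) := by
      rw [tailUnion_eq V (i + 1), tailUnion_eq V (i + 2), ← Set.union_assoc (E (i + 2))]
    -- `V (i + 1)` is kept apart from the copy `E (i + 2)`: its type, block plus gap, will match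
    -- that of a whole rank `s` block followed by its gap.
    refine ⟨headUnion V i ∪ E i, H i, V (i + 1), E (i + 2), H (i + 2), tailUnion V (i + 3),
      ?_, ?_, Or.inr hi, (hE i).2.2, hu _, (hE _).1.ty_eq, (hE _).2.2, ?_, ?_⟩
    · have hEV : ∀ i, E i ⊆ V i := fun i => Set.subset_union_left
      have hHV : ∀ i, H i ⊆ V i := fun i => Set.subset_union_right
      have h0 := headUnion_prec_tailUnion hV i
      have h1 : ∀ j, i ≤ j → Prec (headUnion V i) (V j) := fun j hj =>
        h0.mono subset_rfl (subset_tailUnion hj)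
      have h2 : Prec (headUnion V i) (tailUnion V (i + 3)) := by
        rw [tailUnion_eq V i, tailUnion_eq V (i + 1), tailUnion_eq V (i + 2)] at h0
        simp only [prec_union_right] at h0
        exact h0.2.2.2
      have h3 : ∀ j, j < i + 3 → Prec (V j) (tailUnion V (i + 3)) := fun j hj =>
        prec_tailUnion hV hj
      have h4 : ∀ j, j < i + 3 → Prec (E j) (tailUnion V (i + 3)) := fun j hj =>
        (h3 j hj).mono (hEV j) subset_rfl
      have h5 : ∀ j, j < i + 3 → Prec (H j) (tailUnion V (i + 3)) := fun j hj =>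
        (h3 j hj).mono (hHV j) subset_rfl
      simp only [List.pairwise_cons, List.mem_cons, List.not_mem_nil, or_false, forall_eq_or_imp,
        forall_eq, prec_union_left, IsEmpty.forall_iff, implies_true, and_true,
        List.Pairwise.nil]
      refine ⟨⟨⟨?_, ?_⟩, ⟨?_, ?_⟩, ⟨?_, ?_⟩, ⟨?_, ?_⟩, ?_, ?_⟩, ⟨?_, ?_, ?_, ?_⟩, ⟨?_, ?_, ?_⟩,
        ⟨?_, ?_⟩, ?_⟩
      · exact (h1 i le_rfl).mono subset_rfl (hHV i)
      · exact hEH i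
      · exact h1 _ (by omega)
      · exact (hV i (i + 1) (by omega)).mono (hEV i) subset_rfl
      · exact (h1 _ (by omega)).mono subset_rfl (hEV _)
      · exact (hV i (i + 2) (by omega)).mono (hEV i) (hEV _)
      · exact (h1 _ (by omega)).mono subset_rfl (hHV _)
      · exact (hV i (i + 2) (by omega)).mono (hEV i) (hHV _)
      · exact h2
      · exact h4 i (by omega)
      · exact (hV i (i + 1) (by omega)).mono (hHV i) subset_rfl
      · exact (hV i (i + 2) (by omega)).mono (hHV i) (hEV _)
      · exact (hV i (i + 2) (by omega)).mono (hHV i) (hHV _)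
      · exact h5 i (by omega)
      · exact (hV (i + 1) (i + 2) (by omega)).mono subset_rfl (hEV _)
      · exact (hV (i + 1) (i + 2) (by omega)).mono subset_rfl (hHV _)
      · exact h3 _ (by omega)
      · exact hEH _
      · exact h4 _ (by omega)
      · exact h5 _ (by omega)
    · rw [hT, Set.union_assoc, ← Set.union_assoc (E i), ← tailUnion_eq V i]
      exact iUnion_eq_headUnion_union_tailUnion V i
    · rw [ty_tailUnion hV hu, ht]
    · rw [hT, ty_tailUnion hV hu, ht]
  | succ s hrs ih =>
    rintro D p ⟨-, hty, E, H, hEH, hV, rfl, hE⟩ hpY hpD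
    obtain ⟨i, hi⟩ := Set.mem_iUnion.1 hpD
    replace hi : p ∈ E i := hi.resolve_right fun hp => by
      have : p ∈ Y ∩ H i := ⟨hpY, hp⟩
      rw [(hE i).2.1] at this
      exact this
    let V : ℕ → Set C := fun i => E i ∪ H i
    have hu : ∀ i, ty (V i) N (Matrix.vecCons Y P) = addType (t s) (h s) := fun i => by
      rw [ty_union (hEH i), (hE i).1.ty_eq, (hE i).2.2]
    have ht : omegaType (addType (t s) (h s)) = t (s + 1) := by
      rw [← hty, ty_iUnion_nat hV hu]
    have habs := addType_omegaType hV hu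
    obtain ⟨L, G, B, F, G', Z, hp, hD, hpL, hG, hB, hF, hG', hZ, hM⟩ := ih (hE i).1 hpY hi
    have h1 : Prec (headUnion V i) (V i) :=
      (headUnion_prec_tailUnion hV i).mono subset_rfl (subset_tailUnion le_rfl)
    have h2 : Prec (headUnion V i) (tailUnion V (i + 1)) := by
      have h0 := headUnion_prec_tailUnion hV i
      rw [tailUnion_eq V i, prec_union_right] at h0
      exact h0.2
    have h3 : Prec (V i) (tailUnion V (i + 1)) := prec_tailUnion hV (Nat.lt_succ_self i)
    have h4 := hEH i
    simp only [V, hD, prec_union_left, prec_union_right] at h1 h3 h4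
    simp only [List.pairwise_cons, List.mem_cons, List.not_mem_nil, or_false, forall_eq_or_imp,
      forall_eq, IsEmpty.forall_iff, implies_true, and_true, List.Pairwise.nil] at hp
    refine ⟨headUnion V i ∪ L, G, B, F, G', (Z ∪ H i) ∪ tailUnion V (i + 1), ?_, ?_, Or.inr hpL,
      hG, hB, hF, hG', ?_, ?_⟩
    · simp only [List.pairwise_cons, List.mem_cons, List.not_mem_nil, or_false, forall_eq_or_imp,
        forall_eq, prec_union_left, prec_union_right, IsEmpty.forall_iff, implies_true, and_true,
        List.Pairwise.nil]
      tauto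
    · have h5 := iUnion_eq_headUnion_union_tailUnion V i
      rw [tailUnion_eq] at h5
      refine h5.trans ?_
      simp only [V, hD, Set.union_assoc]
    · rw [ty_union, ty_union, hZ, (hE i).2.2, ty_tailUnion hV hu, habs, ht]
      · tauto
      · simp only [prec_union_left]; tauto
    · have h6 : B ∪ (F ∪ (G' ∪ (Z ∪ H i ∪ tailUnion V (i + 1)))) =
          ((B ∪ (F ∪ (G' ∪ Z))) ∪ H i) ∪ tailUnion V (i + 1) := by
        simp only [Set.union_assoc]
      rw [h6, ty_union, ty_union, hM, (hE i).2.2, ty_tailUnion hV hu, habs, ht]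
      · simp only [prec_union_left]; tauto
      · simp only [prec_union_left]; tauto

end Good
end MSO
namespace MSO

/-! ### Moving a cofinal `ω`-sequence without changing its type. -/

section Uniformization

variable {C : Type*} [LinearOrder C] {n l : ℕ} {P : Fin l → Set C} {Y X : Set C}

/-- One back-and-forth move carried out in each summand separately; equality of types drops from
level `n + 1` to `n`. -/
theorem exists_ty_iUnion_eq {I : Type*} [LinearOrder I] {S S' : I → Set C}
    (hS : ∀ a b, a < b → Prec (S a) (S b)) (hS' : ∀ a b, a < b → Prec (S' a) (S' b))
    {A : Fin l → Set C} (h : ∀ a, ty (S a) (n + 1) A = ty (S' a) (n + 1) A) (X : Set C) :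
    ∃ X', ty (⋃ a, S a) n (append A X) = ty (⋃ a, S' a) n (append A X') ∧
      ∀ a, ty (S a) n (append A X) = ty (S' a) n (append A X') := by
  choose B hB using fun a => exists_ty_eq (h a) X
  obtain ⟨X', hX'⟩ := exists_glue (pairwise_disjoint_of_prec hS') B
  have h1 : ∀ a, ty (S a) n (append A X) = ty (S' a) n (append A X') := fun a => by
    rw [hB a]
    refine ty_congr n fun i => ?_
    induction i using Fin.lastCases with
    | last => simpa using (hX' a).symm
    | cast i => simp
  refine ⟨X', ?_, h1⟩
  rw [ty_iUnion hS, ty_iUnion hS']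
  simp only [h1]

theorem finite_setOf_lt_of_orderIso_nat (e : X ≃o ℕ) {x : C} (hx : x ∈ X) :
    {z ∈ X | z < x}.Finite := by
  refine ((Set.finite_Iio (e ⟨x, hx⟩)).image fun k => (e.symm k : C)).subset ?_
  rintro z ⟨hz, hzx⟩
  exact ⟨e ⟨z, hz⟩, e.strictMono (Subtype.mk_lt_mk.2 hzx), by simp⟩

theorem prec_fin_four {S : Fin 4 → Set C} (h01 : Prec (S 0) (S 1)) (h02 : Prec (S 0) (S 2))
    (h03 : Prec (S 0) (S 3)) (h12 : Prec (S 1) (S 2)) (h13 : Prec (S 1) (S 3))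
    (h23 : Prec (S 2) (S 3)) : ∀ a b, a < b → Prec (S a) (S b) := by
  intro a b hab
  fin_cases a <;> fin_cases b <;> first | assumption | exact absurd hab (by decide)

theorem iUnion_fin_four {C : Type*} {S : Fin 4 → Set C} :
    ⋃ a, S a = S 0 ∪ (S 1 ∪ (S 2 ∪ S 3)) := by
  ext x
  simp [Fin.exists_fin_succ]

/-- The chain `Y` inside a block of positive rank contains a cofinal `ω`-sequence. -/
theorem Good.exists_omega {N r : ℕ} {t h : ℕ → TypeVal N (l + 1)} {D : Set C}
    (hD : Good P Y t h (r + 1) D) (hYD : Y ⊆ D) :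
    ∃ X ⊆ Y, Nonempty (X ≃o ℕ) ∧ ∀ y ∈ Y, ∃ x ∈ X, y < x := by
  obtain ⟨-, -, E, H, hEH, hV, rfl, hE⟩ := hD
  choose y hyY hyE using fun i => (hE i).1.nonempty
  have hy : StrictMono y := fun i j hij => hV i j hij _ (Or.inl (hyE i)) _ (Or.inl (hyE j))
  refine ⟨Set.range y, Set.range_subset_iff.2 hyY, ⟨(hy.orderIso).symm⟩, fun z hz => ?_⟩
  obtain ⟨k, hk⟩ := Set.mem_iUnion.1 (hYD hz)
  exact ⟨y (k + 1), ⟨_, rfl⟩, hV k (k + 1) (Nat.lt_succ_self k) z hk _ (Or.inl (hyE _))⟩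

/-- If `E` and its copy `F` have the same type, as have the segments before them up to the end of
`Q` and the segments after them, then every set that meets `E` but not `F` can be moved without
changing its type. -/
theorem exists_ne_ty_eq_of_pairwise_prec {A : Fin l → Set C} {Q G B F G' Z H E K W U : Set C}
    (hp : [Q, G, B, F, G', Z, H, E, K, W, U].Pairwise Prec)
    (hcov : ∀ x, x ∈ Q ∨ x ∈ G ∨ x ∈ B ∨ x ∈ F ∨ x ∈ G' ∨ x ∈ Z ∨ x ∈ H ∨ x ∈ E ∨ x ∈ K ∨ x ∈ W ∨
      x ∈ U) {t h w : TypeVal (n + 1) l}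
    (hG : ty G (n + 1) A = h) (hB : ty B (n + 1) A = addType t h) (hF : ty F (n + 1) A = t)
    (hG' : ty G' (n + 1) A = h) (hZ : ty Z (n + 1) A = t)
    (hM : ty (B ∪ (F ∪ (G' ∪ Z))) (n + 1) A = t) (hH : ty H (n + 1) A = h)
    (hE : ty E (n + 1) A = t) (hK : ty K (n + 1) A = h) (hW : ty W (n + 1) A = w)
    (hEKW : ty (E ∪ K ∪ W) (n + 1) A = w) (habs : addType (addType t h) w = w)
    (hXE : (X ∩ E).Nonempty) (hXF : X ∩ F = ∅) :
    ∃ X', X' ≠ X ∧ ty Set.univ n (append A X) = ty Set.univ n (append A X') := by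
  simp only [List.pairwise_cons, List.mem_cons, List.not_mem_nil, or_false, forall_eq_or_imp,
    forall_eq, IsEmpty.forall_iff, implies_true, and_true, List.Pairwise.nil] at hp
  have h1 : Prec (B ∪ (F ∪ (G' ∪ Z))) H := by simp [prec_union_left, hp]
  have h2 : Prec G ((B ∪ (F ∪ (G' ∪ Z))) ∪ H) := by simp [prec_union_right, hp]
  have h3 : Prec G B := by simp [hp]
  have h4 : Prec K (W ∪ U) := by simp [prec_union_right, hp]
  have h5 : Prec W U := by simp [hp]
  have h6 : Prec Z H := by simp [hp]
  have h7 : Prec (Z ∪ H) (E ∪ K ∪ W) := by simp [prec_union_left, prec_union_right, hp]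
  have h8 : Prec ((Z ∪ H) ∪ (E ∪ K ∪ W)) U := by simp [prec_union_left, hp]
  have h9 : Prec G' (((Z ∪ H) ∪ (E ∪ K ∪ W)) ∪ U) := by simp [prec_union_right, hp]
  -- Two splittings of the whole chain, around `E` and around `F`. The second summands both have
  -- type `h + (t + h)`, since the whole `B ∪ F ∪ G' ∪ Z` has type `t`. The fourth agree because `Z
  -- ∪ H`, of type `t + h`, is absorbed by `E ∪ K ∪ W`.
  let S : Fin 4 → Set C := ![Q, G ∪ ((B ∪ (F ∪ (G' ∪ Z))) ∪ H), E, K ∪ (W ∪ U)]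
  let S' : Fin 4 → Set C := ![Q, G ∪ B, F, G' ∪ (((Z ∪ H) ∪ (E ∪ K ∪ W)) ∪ U)]
  have hS : ∀ a b, a < b → Prec (S a) (S b) := by
    apply prec_fin_four <;> simp [S, prec_union_left, prec_union_right, hp]
  have hS' : ∀ a b, a < b → Prec (S' a) (S' b) := by
    apply prec_fin_four <;> simp [S', prec_union_left, prec_union_right, hp]
  have hc : ⋃ a, S a = Set.univ := by
    refine Set.eq_univ_of_forall fun x => ?_
    rw [iUnion_fin_four]
    rcases hcov x with h | h | h | h | h | h | h | h | h | h | h <;> simp [S, h]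
  have hc' : ⋃ a, S' a = Set.univ := by
    refine Set.eq_univ_of_forall fun x => ?_
    rw [iUnion_fin_four]
    rcases hcov x with h | h | h | h | h | h | h | h | h | h | h <;> simp [S', h]
  have hty : ∀ a, ty (S a) (n + 1) A = ty (S' a) (n + 1) A := by
    intro a
    fin_cases a
    · rfl
    · change ty (G ∪ ((B ∪ (F ∪ (G' ∪ Z))) ∪ H)) _ _ = ty (G ∪ B) _ _
      rw [ty_union h2, ty_union h1, ty_union h3, hG, hM, hH, hB]
    · exact hE.trans hF.symm
    · change ty (K ∪ (W ∪ U)) _ _ = ty (G' ∪ (((Z ∪ H) ∪ (E ∪ K ∪ W)) ∪ U)) _ _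
      rw [ty_union h4, ty_union h5, ty_union h9, ty_union h8, ty_union h7, ty_union h6, hK, hW,
        hG', hZ, hH, hEKW, habs]
  obtain ⟨X', hX', hX''⟩ := exists_ty_iUnion_eq hS hS' hty X
  rw [hc, hc'] at hX'
  refine ⟨X', ?_, hX'⟩
  rintro rfl
  -- Index `2` compares `E` with `F`: the moved set must meet `F`, which `X` avoids.
  have h10 := inter_nonempty_of_ty_eq n (hX'' 2) (Fin.last l) (by simpa [S] using hXE)
  simp [S', hXF] at h10

/-- If two ranks have the same types, then a cofinal `ω`-sequence in `Y` can be moved without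
changing its type. -/
theorem Good.exists_ne_ty_eq {r s : ℕ} {t h : ℕ → TypeVal (n + 1) (l + 1)} {D : Set C}
    (hD : Good P Y t h (s + 1) D) (hYD : Y ⊆ D) (hrs : r < s) (ht : t r = t s) (hh : h r = h s)
    (hXY : X ⊆ Y) (e : X ≃o ℕ) (hX : ∀ y ∈ Y, ∃ x ∈ X, y ≤ x) :
    ∃ X', X' ≠ X ∧ ty Set.univ n (append (Matrix.vecCons Y P) X) =
      ty Set.univ n (append (Matrix.vecCons Y P) X') := by
  obtain ⟨hDc, -, E, H, hEH, hV, rfl, hE⟩ := hD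
  let V : ℕ → Set C := fun i => E i ∪ H i
  -- The component met by `X` must not be the first one, as the copy is to be found in its
  -- predecessor.
  obtain ⟨i, x, hxX, hxE⟩ : ∃ i, ∃ x ∈ X, x ∈ E (i + 1) := by
    obtain ⟨y, hyY, hyE⟩ := (hE 1).1.nonempty
    obtain ⟨x, hx, hyx⟩ := hX y hyY
    obtain ⟨k, hk⟩ := Set.mem_iUnion.1 (hYD (hXY hx))
    replace hk : x ∈ E k := hk.resolve_right fun hp => by
      have : x ∈ Y ∩ H k := ⟨hXY hx, hp⟩
      rw [(hE k).2.1] at this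
      exact this
    cases k with
    | zero => exact absurd (hV 0 1 Nat.one_pos x (Or.inl hk) y (Or.inl hyE)) hyx.not_gt
    | succ k => exact ⟨k, x, hx, hk⟩
  -- The trace of `X` on `E i` lies below `x ∈ X`, so it is finite; `p` is its last point, or any
  -- point of `Y` there if it is empty.
  obtain ⟨p, hpY, hpE, hpX⟩ : ∃ p ∈ Y, p ∈ E i ∧ ∀ z ∈ X, z ∈ E i → z ≤ p := by
    by_cases hne : (X ∩ E i).Nonempty
    · have hfin : (X ∩ E i).Finite := (finite_setOf_lt_of_orderIso_nat e hxX).subset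
        fun z hz => ⟨hz.1, hV i (i + 1) (Nat.lt_succ_self i) z (Or.inl hz.2) x (Or.inl hxE)⟩
      obtain ⟨p, hp, hmax⟩ := Set.exists_max_image _ id hfin hne
      exact ⟨p, hXY hp.1, hp.2, fun z hz hz' => hmax z ⟨hz, hz'⟩⟩
    · obtain ⟨p, hpY, hpE⟩ := (hE i).1.nonempty
      exact ⟨p, hpY, hpE, fun z hz hz' => absurd ⟨z, hz, hz'⟩ hne⟩
  obtain ⟨L, G, B, F, G', Z, hp, hEi, hpL, hG, hB, hF, hG', hZ, hM⟩ :=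
    (hE i).1.exists_cut hrs hpY hpE
  have hu : ∀ i, ty (V i) (n + 1) (Matrix.vecCons Y P) = addType (t s) (h s) := fun i => by
    rw [ty_union (hEH i), (hE i).1.ty_eq, (hE i).2.2]
  have habs := addType_omegaType hV hu
  -- The block need not fill the chain: `Q` adds to `L` everything below it and `U` is everything
  -- above the block. Convexity of the block ensures that nothing is left out.
  let Q : Set C := {x | ∃ q ∈ L, x ≤ q}
  let U : Set C := {x | ∀ d ∈ ⋃ i, (E i ∪ H i), d < x}
  have hQ : ∀ {T : Set C}, Prec L T → Prec Q T := fun hT x ⟨q, hq, hxq⟩ y hy =>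
    hxq.trans_lt (hT q hq y hy)
  have hcov : ∀ x, x ∈ Q ∨ x ∈ E i ∨ x ∈ H i ∨ x ∈ E (i + 1) ∨ x ∈ H (i + 1) ∨
      x ∈ tailUnion V (i + 2) ∨ x ∈ U := by
    intro x
    by_cases hxp : x ≤ p
    · exact Or.inl ⟨p, hpL, hxp⟩
    by_cases hxD : x ∈ ⋃ i, (E i ∪ H i)
    · have h1 := iUnion_eq_headUnion_union_tailUnion V i
      rw [tailUnion_eq, tailUnion_eq V (i + 1)] at h1
      rw [h1] at hxD
      simp only [Set.mem_union, V] at hxD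
      have h2 : x ∉ headUnion V i := fun ⟨k, hk, hx⟩ =>
        hxp (hV k i hk x hx p (Or.inl hpE)).le
      tauto
    · have h3 : x ∈ U := fun d hd => by
        by_contra hdx
        exact hxD (hDc.out (Set.mem_iUnion.2 ⟨i, Or.inl hpE⟩) hd
          ⟨(not_le.1 hxp).le, not_lt.1 hdx⟩)
      tauto
  have hVU : ∀ k, Prec (V k) U := fun k z hz y hy => hy z (Set.mem_iUnion.2 ⟨k, hz⟩)
  have hTU : ∀ k, Prec (tailUnion V k) U := fun k z hz y hy => by
    obtain ⟨j, hj⟩ := Set.mem_iUnion.1 hz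
    exact hVU _ z hj y hy
  have h1 := hEH i
  have h2 := hEH (i + 1)
  have h3 := hV i (i + 1) (Nat.lt_succ_self i)
  have h5 : Prec (V i) (tailUnion V (i + 2)) := prec_tailUnion hV (by omega)
  have h6 : Prec (V (i + 1)) (tailUnion V (i + 2)) := prec_tailUnion hV (by omega)
  have h7 := hVU i
  have h8 := hVU (i + 1)
  have h10 := hTU (i + 2)
  have hEKW : E (i + 1) ∪ H (i + 1) ∪ tailUnion V (i + 2) = tailUnion V (i + 1) :=
    (tailUnion_eq V (i + 1)).symm
  have hW := ty_tailUnion hV hu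
  simp only [V, hEi, prec_union_left, prec_union_right] at h1 h3 h5 h7
  simp only [V, prec_union_left] at h6 h8
  simp only [List.pairwise_cons, List.mem_cons, List.not_mem_nil, or_false, forall_eq_or_imp,
    forall_eq, IsEmpty.forall_iff, implies_true, and_true, List.Pairwise.nil] at hp
  refine exists_ne_ty_eq_of_pairwise_prec (Q := Q) (H := H i) (E := E (i + 1)) (K := H (i + 1))
    (W := tailUnion V (i + 2)) (U := U) ?_ (fun x => ?_) (hG.trans hh) (by rw [hB, ht, hh])
    (hF.trans ht) (hG'.trans hh) hZ hM (hE i).2.2 (hE _).1.ty_eq (hE _).2.2 (hW _)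
    (by rw [hEKW, hW]) habs ⟨x, hxX, hxE⟩ ?_
  · simp [V, hp, h1, h2, h3, h5, h6, h7, h8, h10, hQ]
  · have hLQ : x ∈ L → x ∈ Q := fun hx => ⟨x, hx, le_rfl⟩
    have h := hcov x
    rw [hEi] at h
    simp only [Set.mem_union] at h
    clear * - h hLQ
    tauto
  · refine Set.eq_empty_of_forall_notMem fun z ⟨hz, hzF⟩ => ?_
    exact (hpX z hz (by rw [hEi]; simp [hzF])).not_gt (hp.1.2.2.1 p hpL z hzF)

/-- Formulas of bounded depth with a bounded number of parameters do not choose cofinal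
`ω`-sequences in chains that contain a large finite power of `ω`. -/
theorem exists_forall_rich_not_uniformizes (n l : ℕ) : ∃ m, ∀ (C : Type) [LinearOrder C],
    Rich m (Set.univ : Set C) → ∀ (ψ : Formula (l + 2)) (P : Fin l → Set C),
      DecidedBy ψ n → ¬ Uniformizes C ψ P Formula.omegaCofinal := by
  -- Ranks `0` up to the number of pairs of types already force a repetition `r < s`; one further
  -- rank makes a block of rank `s + 1` available. Types are taken at level `n + 1` because moving
  -- `X` costs one level.
  refine ⟨Nat.card (TypeVal (n + 1) (l + 1) × TypeVal (n + 1) (l + 1)) + 1,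
    fun C _ hC ψ P hψ hU => ?_⟩
  obtain ⟨D₀, Y₀, t, h, -, -, hG₀⟩ := hC.exists_good P (n + 1)
  obtain ⟨r, s, hrs, hs, ht, hh⟩ : ∃ r s, r < s ∧
      s ≤ Nat.card (TypeVal (n + 1) (l + 1) × TypeVal (n + 1) (l + 1)) ∧
      t r = t s ∧ h r = h s := by
    have := Fintype.ofFinite (TypeVal (n + 1) (l + 1) × TypeVal (n + 1) (l + 1))
    obtain ⟨a, b, hab, hfab⟩ := Fintype.exists_ne_map_eq_of_card_lt
      (fun k : Fin (Nat.card (TypeVal (n + 1) (l + 1) × TypeVal (n + 1) (l + 1)) + 1) =>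
        (t k, h k)) (by simp [Nat.card_eq_fintype_card])
    simp only [Prod.mk.injEq] at hfab
    rcases lt_or_gt_of_ne hab with h1 | h1
    · exact ⟨a, b, h1, by omega, hfab⟩
    · exact ⟨b, a, h1, by omega, hfab.1.symm, hfab.2.symm⟩
  obtain ⟨D, -, hG₁⟩ := hG₀.exists_subset (r := s + 1) (by omega)
  -- Restricting to one block of rank `s + 1` makes cofinality in `Y` mean cofinality in that block.
  let Y := Y₀ ∩ D
  have hYD : Y ⊆ D := Set.inter_subset_right
  have hG : Good P Y t h (s + 1) D := hG₁.congr
    (by simp [Y, Set.inter_assoc]) (fun _ _ => rfl) fun _ _ => rfl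
  obtain ⟨X₀, hX₀Y, hX₀, hX₀c⟩ := hG.exists_omega hYD
  have hY : Y.Nonempty ∧ ¬ ∃ y, IsGreatest Y y := by
    refine ⟨hG.nonempty.mono Set.inter_subset_left, ?_⟩
    rintro ⟨y, hy, hy'⟩
    obtain ⟨x, hx, hyx⟩ := hX₀c y hy
    exact (hy' (hX₀Y hx)).not_gt hyx
  obtain ⟨X, hX, huniq⟩ := hU.1 Y ⟨X₀, (sat_omegaCofinal _).2 ⟨fun _ => ⟨hX₀Y, hX₀, fun y hy => by
    obtain ⟨x, hx, hyx⟩ := hX₀c y hy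
    exact ⟨x, hx, hyx.le⟩⟩, fun h => absurd hY h⟩⟩
  obtain ⟨hXY, ⟨e⟩, hXc⟩ := ((sat_omegaCofinal _).1 (hU.2 X Y hX)).1 hY
  obtain ⟨X', hne, hty⟩ := hG.exists_ne_ty_eq hYD hrs ht hh hXY e hXc
  refine hne (huniq X' ?_)
  -- The formula has `X` as first variable while types append it last; the permutation reconciles
  -- the two.
  have key : ∀ X : Set C, Matrix.vecCons X (Matrix.vecCons Y P) =
      append (Matrix.vecCons Y P) X ∘ Fin.cons (Fin.last (l + 1)) Fin.castSucc := by
    intro X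
    funext i
    induction i using Fin.cases with
    | zero => simp
    | succ i => simp
  have hTh := Th_eq_of_ty_eq n (ty_comp n (Fin.cons (Fin.last (l + 1)) Fin.castSucc) hty)
  rw [← key, ← key] at hTh
  exact (hψ C C _ _ hTh).1 hX

end Uniformization

/-! ### Powers of `ω` inside ordinals. -/

section Ordinals

theorem Rich.mono {C : Type*} [LinearOrder C] {r : ℕ} {S T : Set C} (hS : Rich r S)
    (hST : S ⊆ T) : Rich r T := by
  cases r with
  | zero => exact Set.Nonempty.mono hST hS
  | succ r =>
    obtain ⟨f, hf, hfS⟩ := hS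
    exact ⟨f, hf, fun i => ⟨(hfS i).1.trans hST, (hfS i).2⟩⟩

-- The interval of length `ω ^ (r + 1)` starting at `a` contains the consecutive intervals of length
-- `ω ^ r` starting at `a + ω ^ r * i`. A general starting point is needed for the induction.
open Ordinal in
theorem rich_toType_of_add_le {o : Ordinal.{0}} (r : ℕ) : ∀ a : Ordinal.{0}, a + ω ^ r ≤ o →
    Rich r (ToType.mk '' {x : Set.Iio o | a ≤ x.1 ∧ x.1 < a + ω ^ r}) := by
  induction r with
  | zero =>
    intro a ha
    have h1 : a < a + ω ^ 0 := by simp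
    exact ⟨_, ⟨a, h1.trans_le ha⟩, ⟨le_rfl, h1⟩, rfl⟩
  | succ r ih =>
    intro a ha
    have h1 : ∀ i : ℕ, a + ω ^ r * i + ω ^ r = a + ω ^ r * (i + 1 : ℕ) := fun i => by
      rw [add_assoc, Nat.cast_succ, mul_add_one]
    have h2 : ∀ i : ℕ, a + ω ^ r * i + ω ^ r ≤ a + ω ^ (r + 1) := fun i => by
      rw [h1, pow_succ]
      gcongr
      exact (natCast_lt_omega0 _).le
    refine ⟨fun i => ToType.mk '' {x : Set.Iio o | a + ω ^ r * i ≤ x.1 ∧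
      x.1 < a + ω ^ r * i + ω ^ r}, ?_, fun i => ⟨Set.image_mono ?_, ih _ ((h2 i).trans ha)⟩⟩
    · rintro i j hij _ ⟨x, hx, rfl⟩ _ ⟨y, hy, rfl⟩
      refine ToType.mk.strictMono (Subtype.coe_lt_coe.1 (hx.2.trans_le (le_trans ?_ hy.1)))
      rw [h1]
      gcongr
      exact hij
    · rintro x ⟨hx, hx'⟩
      exact ⟨le_self_add.trans hx, hx'.trans_le (h2 i)⟩

open Ordinal in
theorem rich_univ_toType {o : Ordinal.{0}} {r : ℕ} (h : ω ^ r ≤ o) :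
    Rich r (Set.univ : Set o.ToType) :=
  (rich_toType_of_add_le r 0 (by simpa using h)).mono (Set.subset_univ _)

end Ordinals

theorem decidedBy_dp {l : ℕ} (ψ : Formula l) : DecidedBy ψ (dp ψ) :=
  Nat.sInf_mem (s := {n | DecidedBy ψ n}) ⟨_, decidedBy_qdepth ψ⟩

end MSO

theorem proposition5p2 :
    (∀ (l : ℕ) (ψ : MSO.Formula (l + 2))
        (P : Fin l → Set (Ordinal.omega0.{0} ^ Ordinal.omega0.{0}).ToType),
      ¬ MSO.Uniformizes (Ordinal.omega0.{0} ^ Ordinal.omega0.{0}).ToType ψ P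
        MSO.Formula.omegaCofinal) ∧
    (∀ (l : ℕ → ℕ) (ψ : (m : ℕ) → MSO.Formula (l m + 2))
        (P : (m : ℕ) → Fin (l m) → Set (Ordinal.omega0.{0} ^ m).ToType),
      (∀ m : ℕ, MSO.Uniformizes (Ordinal.omega0.{0} ^ m).ToType (ψ m) (P m)
        MSO.Formula.omegaCofinal) →
      ¬ BddAbove (Set.range fun m : ℕ => MSO.dp (ψ m)) ∨ ¬ BddAbove (Set.range l)) := by
  choose f hf using MSO.exists_forall_rich_not_uniformizes
  constructor
  · intro l ψ P
    refine hf (MSO.dp ψ) l _ (MSO.rich_univ_toType ?_) ψ P (MSO.decidedBy_dp ψ)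
    rw [← Ordinal.opow_natCast]
    exact Ordinal.opow_le_opow_right Ordinal.omega0_pos (Ordinal.natCast_lt_omega0 _).le
  · intro l ψ P hU
    by_contra! hbd
    obtain ⟨⟨N, hN⟩, ⟨L, hL⟩⟩ := hbd
    -- Under both bounds only finitely many pairs of depth and parameter count occur, so a single
    -- power of `ω` defeats them all.
    let m := (Finset.range (N + 1) ×ˢ Finset.range (L + 1)).sup fun q => f q.1 q.2
    have hm : f (MSO.dp (ψ m)) (l m) ≤ m := by
      have h1 : MSO.dp (ψ m) ≤ N := hN ⟨m, rfl⟩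
      have h2 : l m ≤ L := hL ⟨m, rfl⟩
      exact Finset.le_sup (f := fun q : ℕ × ℕ => f q.1 q.2) (b := (MSO.dp (ψ m), l m))
        (by simp only [Finset.mem_product, Finset.mem_range]; omega)
    refine hf (MSO.dp (ψ m)) (l m) _ (MSO.rich_univ_toType ?_) (ψ m) (P m)
      (MSO.decidedBy_dp (ψ m)) (hU m)
    exact pow_le_pow_right₀ (Order.one_le_iff_pos.2 Ordinal.omega0_pos) hm
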